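/- Let $k$ be a field and $H$ a Hopf algebra over $k$ with bijective antipode $\mathcal S$. Consider the braided category of (not necessarily finite-dimensional) left Yetter--Drinfeld modules over $H$, i.e. left $H$-modules and left $H$-comodules $M$ with $\delta(hm)=h_{(1)}m_{(-1)}\mathcal S(h_{(3)})\otimes h_{(2)}m_{(0)}$, with braiding $c(m\otimes n)=m_{(-1)}n\otimes m_{(0)}$. A TOBA is a graded Hopf algebra $R=\bigoplus_{n\ge 0}R(n)$ in this category (the $R(n)$ are Yetter--Drinfeld submodules, $R(i)R(j)\subseteq R(i+j)$, $\Delta(R(n))\subseteq\bigoplus_{i+j=n}R(i)\otimes R(j)$) such that $R(0)\simeq k$, $\left(\bigoplus_{i\ge 1}R(i)\right)^2=\bigoplus_{i\ge 2}R(i)$, and the space $\{x\in R : \Delta(x)=x\otimes 1+1\otimes x\}$ of primitive elements equals $R(1)$. For a Yetter--Drinfeld module $V$, let $A(V)$ be the tensor algebra of $V$ with the diagonal action and coaction and with the comultiplication which is the algebra map to the braided tensor product $A(V)\otimes A(V)$ determined by $\Delta(v)=v\otimes 1+1\otimes v$ for $v\in V$. For $w\in\mathbb S_n$ let $s(w)=c_{i_1}\cdots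 c_{i_j}\in\operatorname{End}(V^{\otimes n})$, where $w=\tau_{i_1}\cdots\tau_{i_j}$ is a word of minimal length in the elementary transpositions $\tau_i=(i,i+1)$ and $c_i$ is the braiding $c_{V,V}$ applied to the tensor factors $i,i+1$. Let $\mathfrak S^n=\sum_{w\in\mathbb S_n}s(w)$, $\mathfrak S=\bigoplus_n\mathfrak S^n$, and $\mathfrak B(V)=A(V)/\ker\mathfrak S$ with the structure induced from $A(V)$. Let $R$ be a TOBA, $V=R(1)$, and let $p:A(V)\to R$ be the algebra map induced by the inclusion $V\hookrightarrow R$. Then: 1. $p$ is surjective and $\ker p=\ker\mathfrak S$; 2. $p$ induces an isomorphism $\mathfrak B(V)\simeq R$ of graded Hopf algebras in the category of Yetter--Drinfeld modules; 3. a TOBA is determined up to isomorphism by its space of primitive elements: if $R'$ is another TOBA over $H$ and $f:R(1)\to R'(1)$ is an isomorphism of Yetter--Drinfeld modules, then there is an isomorphism $R\to R'$ of graded Hopf algebras in the category of Yetter--Drinfeld modules which extends $f$. -/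

import Mathlib

open scoped TensorProduct DirectSum

noncomputable section

/-! ### Yetter–Drinfeld modules -/

section YD

variable {k H M N : Type*} [Field k] [Ring H] [HopfAlgebra k H]
  [AddCommGroup M] [Module k M] [AddCommGroup N] [Module k N]

/-- The structure maps of a left `H`-module and left `H`-comodule on `M` (without axioms; see
`YDData.IsYetterDrinfeld`): `act h m = h • m` and `coact m = m₍₋₁₎ ⊗ m₍₀₎`. -/
structure YDData (k H M : Type*) [Field k] [Ring H] [HopfAlgebra k H]
    [AddCommGroup M] [Module k M] where
  act : H →ₗ[k] Module.End k M
  coact : M →ₗ[k] H ⊗[k] M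

namespace YDData

/-- `a ⊗ c ↦ (x ↦ a * x * S c)` on a Hopf algebra `H` with antipode `S`. -/
def mulAntipode (k H : Type*) [Field k] [Ring H] [HopfAlgebra k H] :
    H ⊗[k] H →ₗ[k] Module.End k H :=
  TensorProduct.lift (LinearMap.mk₂ k
    (fun a c => LinearMap.mulLeft k a ∘ₗ LinearMap.mulRight k (HopfAlgebra.antipode k c))
    (by intros; ext; simp [add_mul]) (by intros; ext; simp)
    (by intros; ext; simp [mul_add]) (by intros; ext; simp))

/-- The map `h ↦ (x ⊗ m ↦ h₍₁₎ x S(h₍₃₎) ⊗ h₍₂₎ • m)`. -/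
def twistedAct (D : YDData k H M) : H →ₗ[k] Module.End k (H ⊗[k] M) :=
  TensorProduct.homTensorHomMap (.id k) H M H M
    ∘ₗ TensorProduct.map (mulAntipode k H) D.act
    ∘ₗ (TensorProduct.assoc k H H H).symm.toLinearMap
    ∘ₗ (TensorProduct.comm k H H).toLinearMap.lTensor H
    ∘ₗ (Coalgebra.comul (R := k) (A := H)).lTensor H
    ∘ₗ Coalgebra.comul

/-- `M` is a left Yetter–Drinfeld module over `H`: a left module, a left comodule, and
`δ(h • m) = h₍₁₎ m₍₋₁₎ S(h₍₃₎) ⊗ h₍₂₎ • m₍₀₎`. -/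
structure IsYetterDrinfeld (D : YDData k H M) : Prop where
  act_one : D.act 1 = 1
  act_mul : ∀ g h : H, D.act (g * h) = D.act g * D.act h
  coassoc : (TensorProduct.assoc k H H M).toLinearMap ∘ₗ
    (Coalgebra.comul (R := k) (A := H)).rTensor M ∘ₗ D.coact = D.coact.lTensor H ∘ₗ D.coact
  counit_coact : (TensorProduct.lid k M).toLinearMap ∘ₗ
    (Coalgebra.counit (R := k) (A := H)).rTensor M ∘ₗ D.coact = LinearMap.id
  coact_act : ∀ (h : H) (m : M), D.coact (D.act h m) = D.twistedAct h (D.coact m)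

/-- Morphisms of Yetter–Drinfeld modules: linear maps that are `H`-linear and `H`-colinear. -/
structure IsHom (D : YDData k H M) (D' : YDData k H N) (f : M →ₗ[k] N) : Prop where
  map_act : ∀ (h : H) (m : M), f (D.act h m) = D'.act h (f m)
  map_coact : ∀ m : M, D'.coact (f m) = f.lTensor H (D.coact m)

/-- The unit object: `k` with the trivial action `h • a = ε(h) a` and coaction `a ↦ 1 ⊗ a`. -/
def unit (k H : Type*) [Field k] [Ring H] [HopfAlgebra k H] : YDData k H k where
  act := (LinearMap.lsmul k k) ∘ₗ Coalgebra.counit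
  coact := TensorProduct.mk k H k 1

/-- The tensor product: diagonal action `h • (m ⊗ n) = h₍₁₎ • m ⊗ h₍₂₎ • n` and coaction
`m ⊗ n ↦ m₍₋₁₎ n₍₋₁₎ ⊗ (m₍₀₎ ⊗ n₍₀₎)`. -/
def tensor (D : YDData k H M) (D' : YDData k H N) : YDData k H (M ⊗[k] N) where
  act := TensorProduct.homTensorHomMap (.id k) M N M N ∘ₗ TensorProduct.map D.act D'.act
    ∘ₗ Coalgebra.comul
  coact := (LinearMap.mul' k H).rTensor (M ⊗[k] N)
    ∘ₗ (TensorProduct.tensorTensorTensorComm k H M H N).toLinearMap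
    ∘ₗ TensorProduct.map D.coact D'.coact

/-- The braiding `c_{M,N} : M ⊗ N → N ⊗ M`, `m ⊗ n ↦ m₍₋₁₎ • n ⊗ m₍₀₎`. -/
def braiding (D : YDData k H M) (D' : YDData k H N) : M ⊗[k] N →ₗ[k] N ⊗[k] M :=
  (TensorProduct.lift D'.act).rTensor M
    ∘ₗ (TensorProduct.assoc k H N M).symm.toLinearMap
    ∘ₗ (TensorProduct.comm k M N).toLinearMap.lTensor H
    ∘ₗ (TensorProduct.assoc k H M N).toLinearMap
    ∘ₗ D.coact.rTensor N

/-- A subspace stable under the action and the coaction (`δ(W) ⊆ H ⊗ W`). -/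
structure IsSub (D : YDData k H M) (W : Submodule k M) : Prop where
  act_mem : ∀ (h : H), ∀ m ∈ W, D.act h m ∈ W
  coact_mem : ∀ m ∈ W, D.coact m ∈ LinearMap.range (W.subtype.lTensor H)

/-- The Yetter–Drinfeld structure induced on a stable subspace. -/
def restrict (D : YDData k H M) (W : Submodule k M) (hW : D.IsSub W) : YDData k H W where
  act := LinearMap.mk₂ k (fun h (w : W) => (⟨D.act h w, hW.act_mem h w w.2⟩ : W))
    (by intros; ext; simp) (by intros; ext; simp) (by intros; ext; simp) (by intros; ext; simp)
  coact := (LinearEquiv.ofInjective (W.subtype.lTensor H)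
      (Module.Flat.lTensor_preserves_injective_linearMap _ W.injective_subtype)).symm.toLinearMap
    ∘ₗ LinearMap.codRestrict _ (D.coact ∘ₗ W.subtype) (fun w => hW.coact_mem w w.2)

end YDData

end YD

/-! ### Braided Hopf algebras and TOBAs -/

section Hopf

variable {k H R : Type*} [Field k] [Ring H] [HopfAlgebra k H] [Ring R] [Algebra k R]

/-- The product `(m ⊗ m)(id ⊗ c ⊗ id)` of the braided tensor product algebra `R ⊗ R`. -/
def YDData.braidedMul (D : YDData k H R) :
    (R ⊗[k] R) ⊗[k] (R ⊗[k] R) →ₗ[k] R ⊗[k] R :=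
  TensorProduct.map (LinearMap.mul' k R) (LinearMap.mul' k R)
    ∘ₗ (TensorProduct.assoc k R R (R ⊗[k] R)).symm.toLinearMap
    ∘ₗ ((TensorProduct.assoc k R R R).toLinearMap
        ∘ₗ (D.braiding D).rTensor R
        ∘ₗ (TensorProduct.assoc k R R R).symm.toLinearMap).lTensor R
    ∘ₗ (TensorProduct.assoc k R R (R ⊗[k] R)).toLinearMap

variable [Coalgebra k R]

/-- `R` is a Hopf algebra in the braided category of left Yetter–Drinfeld modules over `H`. -/
structure IsBraidedHopfAlgebra (D : YDData k H R) : Prop where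
  yetterDrinfeld : D.IsYetterDrinfeld
  mul_hom : (D.tensor D).IsHom D (LinearMap.mul' k R)
  unit_hom : (YDData.unit k H).IsHom D (Algebra.linearMap k R)
  comul_hom : D.IsHom (D.tensor D) Coalgebra.comul
  counit_hom : D.IsHom (YDData.unit k H) Coalgebra.counit
  counit_one : Coalgebra.counit (R := k) (1 : R) = 1
  counit_mul : ∀ x y : R, Coalgebra.counit (R := k) (x * y) =
    Coalgebra.counit (R := k) x * Coalgebra.counit (R := k) y
  comul_one : Coalgebra.comul (R := k) (1 : R) = 1 ⊗ₜ[k] 1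
  comul_mul : ∀ x y : R, Coalgebra.comul (R := k) (x * y) =
    D.braidedMul (Coalgebra.comul (R := k) x ⊗ₜ[k] Coalgebra.comul (R := k) y)
  exists_antipode : ∃ S : R →ₗ[k] R, D.IsHom D S ∧
    LinearMap.mul' k R ∘ₗ S.rTensor R ∘ₗ Coalgebra.comul =
      Algebra.linearMap k R ∘ₗ Coalgebra.counit ∧
    LinearMap.mul' k R ∘ₗ S.lTensor R ∘ₗ Coalgebra.comul =
      Algebra.linearMap k R ∘ₗ Coalgebra.counit

/-- A grading `R = ⨁ₙ R(n)` by Yetter–Drinfeld submodules making `R` a graded Hopf algebra. -/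
structure IsGradedBraidedHopfAlgebra (D : YDData k H R) (𝒜 : ℕ → Submodule k R) : Prop
    extends IsBraidedHopfAlgebra D where
  isInternal : DirectSum.IsInternal 𝒜
  isSub : ∀ n, D.IsSub (𝒜 n)
  mul_mem : ∀ i j, ∀ x ∈ 𝒜 i, ∀ y ∈ 𝒜 j, x * y ∈ 𝒜 (i + j)
  comul_mem : ∀ n, ∀ x ∈ 𝒜 n, Coalgebra.comul (R := k) x ∈
    ⨆ (i : ℕ) (j : ℕ) (_ : i + j = n),
      LinearMap.range (TensorProduct.map (𝒜 i).subtype (𝒜 j).subtype)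

/-- The space of primitive elements `{x | Δ(x) = 1 ⊗ x + x ⊗ 1}`. -/
def primitives (k R : Type*) [Field k] [Ring R] [Algebra k R] [Coalgebra k R] :
    Submodule k R :=
  LinearMap.eqLocus (Coalgebra.comul (R := k) (A := R))
    (TensorProduct.mk k R R 1 + (TensorProduct.mk k R R).flip 1)

/-- Braided Hopf algebras of type one. -/
structure IsTOBA (D : YDData k H R) (𝒜 : ℕ → Submodule k R) : Prop
    extends IsGradedBraidedHopfAlgebra D 𝒜 where
  zero_equiv : Nonempty (𝒜 0 ≃ₗ[k] k)
  sq_augmentation : (⨆ i ≥ 1, 𝒜 i) * (⨆ i ≥ 1, 𝒜 i) = ⨆ i ≥ 2, 𝒜 i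
  primitives_eq : primitives k R = 𝒜 1

/-- The Yetter–Drinfeld module `V = R(1)`. -/
def IsTOBA.degreeOne {D : YDData k H R} {𝒜 : ℕ → Submodule k R} (h : IsTOBA D 𝒜) :
    YDData k H (𝒜 1) :=
  D.restrict (𝒜 1) (h.isSub 1)

end Hopf

/-! ### Reduced words in the symmetric group -/

namespace SymmGroup

/-- Indices of the elementary transpositions of `Fin n`. -/
abbrev Idx (n : ℕ) := {i : ℕ // i + 1 < n}

/-- The left position `i` of the elementary transposition `(i, i+1)`. -/
def Idx.left {n : ℕ} (i : Idx n) : Fin n := ⟨i.1, Nat.lt_of_succ_lt i.2⟩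

/-- The right position `i + 1` of the elementary transposition `(i, i+1)`. -/
def Idx.right {n : ℕ} (i : Idx n) : Fin n := ⟨i.1 + 1, i.2⟩

/-- The permutation `τ_{i₁} ⋯ τ_{iⱼ}` represented by a word. -/
def wordPerm {n : ℕ} (l : List (Idx n)) : Equiv.Perm (Fin n) :=
  (l.map fun i => Equiv.swap i.left i.right).prod

/-- `l` is a word of minimal length representing the permutation `w`. -/
def IsReducedWord {n : ℕ} (w : Equiv.Perm (Fin n)) (l : List (Idx n)) : Prop :=
  wordPerm l = w ∧ ∀ l', wordPerm l' = w → l.length ≤ l'.length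

theorem exists_word {n : ℕ} (w : Equiv.Perm (Fin n)) : ∃ l, wordPerm l = w := by
  cases n with
  | zero => exact ⟨[], Subsingleton.elim _ _⟩
  | succ n =>
    have hw : w ∈ Submonoid.closure
        (Set.range fun i : Fin n => Equiv.swap i.castSucc i.succ) := by
      rw [Equiv.Perm.mclosure_swap_castSucc_succ]; trivial
    induction hw using Submonoid.closure_induction with
    | mem x hx =>
      obtain ⟨i, rfl⟩ := hx
      exact ⟨[⟨i.1, by omega⟩], by simp [wordPerm]; rfl⟩
    | one => exact ⟨[], rfl⟩
    | mul x y _ _ hx hy =>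
      obtain ⟨l, rfl⟩ := hx
      obtain ⟨l', rfl⟩ := hy
      exact ⟨l ++ l', by simp [wordPerm]⟩

theorem exists_reducedWord {n : ℕ} (w : Equiv.Perm (Fin n)) : ∃ l, IsReducedWord w l := by
  classical
  have h : ∃ m, ∃ l, wordPerm l = w ∧ l.length = m :=
    let ⟨l, hl⟩ := exists_word w; ⟨_, l, hl, rfl⟩
  obtain ⟨l, hl, hm⟩ := Nat.find_spec h
  exact ⟨l, hl, fun l' hl' => hm ▸ Nat.find_min' h ⟨l', hl', rfl⟩⟩

/-- A word of minimal length representing `w`. -/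
def reducedWord {n : ℕ} (w : Equiv.Perm (Fin n)) : List (Idx n) :=
  (exists_reducedWord w).choose

end SymmGroup

/-! ### The quantum symmetrizer -/

section Symmetrizer

variable {k H V : Type*} [Field k] [Ring H] [HopfAlgebra k H] [AddCommGroup V] [Module k V]

open Function in
/-- `a ⊗ b ↦ v₁ ⊗ ⋯ ⊗ a ⊗ ⋯ ⊗ b ⊗ ⋯ ⊗ vₙ`, with `a` at position `i` and `b` at position `j`. -/
def insertPair {n : ℕ} (i j : Fin n) (hij : i ≠ j) (v : Fin n → V) :
    V ⊗[k] V →ₗ[k] ⨂[k]^n V :=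
  TensorProduct.lift (LinearMap.mk₂ k
    (fun a b => PiTensorProduct.tprod k (update (update v i a) j b))
    (by intro a a' b
        simp only [update_comm hij]
        exact (PiTensorProduct.tprod k).map_update_add _ _ _ _)
    (by intro c a b
        simp only [update_comm hij]
        exact (PiTensorProduct.tprod k).map_update_smul _ _ _ _)
    (by intros; exact (PiTensorProduct.tprod k).map_update_add _ _ _ _)
    (by intros; exact (PiTensorProduct.tprod k).map_update_smul _ _ _ _))

open Function in
theorem insertPair_tmul {n : ℕ} (i j : Fin n) (hij : i ≠ j) (v : Fin n → V) (a b : V) :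
    insertPair (k := k) i j hij v (a ⊗ₜ b) =
      PiTensorProduct.tprod k (update (update v i a) j b) := rfl

open Function in
theorem insertPair_update_left {n : ℕ} (i j : Fin n) (hij : i ≠ j) (v : Fin n → V) (x : V) :
    insertPair (k := k) i j hij (update v i x) = insertPair i j hij v := by
  ext a b
  simp [insertPair_tmul]

open Function in
theorem insertPair_update_right {n : ℕ} (i j : Fin n) (hij : i ≠ j) (v : Fin n → V) (x : V) :
    insertPair (k := k) i j hij (update v j x) = insertPair i j hij v := by
  ext a b
  simp [insertPair_tmul, update_comm hij]

open Function in
theorem insertPair_update_add {n : ℕ} (i j : Fin n) (hij : i ≠ j) (v : Fin n → V) (m : Fin n)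
    (hi : m ≠ i) (hj : m ≠ j) (x y : V) :
    insertPair (k := k) i j hij (update v m (x + y)) =
      insertPair i j hij (update v m x) + insertPair i j hij (update v m y) := by
  ext a b
  have h : ∀ z : V, update (update (update v m z) i a) j b
      = update (update (update v i a) j b) m z := by
    intro z; rw [update_comm hi, update_comm hj]
  simp [insertPair_tmul, h]

open Function in
theorem insertPair_update_smul {n : ℕ} (i j : Fin n) (hij : i ≠ j) (v : Fin n → V) (m : Fin n)
    (hi : m ≠ i) (hj : m ≠ j) (c : k) (x : V) :
    insertPair (k := k) i j hij (update v m (c • x)) =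
      c • insertPair (k := k) i j hij (update v m x) := by
  ext a b
  have h : ∀ z : V, update (update (update v m z) i a) j b
      = update (update (update v i a) j b) m z := by
    intro z; rw [update_comm hi, update_comm hj]
  simp [insertPair_tmul, h]

/-- The endomorphism of `V^{⊗n}` applying `c : V ⊗ V → V ⊗ V` at the positions `i ≠ j`. -/
def applyAt (c : V ⊗[k] V →ₗ[k] V ⊗[k] V) {n : ℕ} (i j : Fin n) (hij : i ≠ j) :
    Module.End k (⨂[k]^n V) :=
  PiTensorProduct.lift (MultilinearMap.mk' (fun v => insertPair i j hij v (c (v i ⊗ₜ v j)))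
    (by
      intro v m x y
      by_cases hi : m = i
      · subst hi
        simp [insertPair_update_left, Function.update_of_ne hij.symm, TensorProduct.add_tmul]
      · by_cases hj : m = j
        · subst hj
          simp [insertPair_update_right, Function.update_of_ne hij, TensorProduct.tmul_add]
        · simp [insertPair_update_add i j hij v m hi hj, Function.update_of_ne (Ne.symm hi),
            Function.update_of_ne (Ne.symm hj)])
    (by
      intro v m x y
      by_cases hi : m = i
      · subst hi
        simp [insertPair_update_left, Function.update_of_ne hij.symm,
          ← TensorProduct.smul_tmul']
      · by_cases hj : m = j
        · subst hj
          simp [insertPair_update_right, Function.update_of_ne hij]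
        · simp [insertPair_update_smul i j hij v m hi hj, Function.update_of_ne (Ne.symm hi),
            Function.update_of_ne (Ne.symm hj)]))

theorem applyAt_tprod (c : V ⊗[k] V →ₗ[k] V ⊗[k] V) {n : ℕ} (i j : Fin n) (hij : i ≠ j)
    (v : Fin n → V) :
    applyAt c i j hij (PiTensorProduct.tprod k v) = insertPair i j hij v (c (v i ⊗ₜ v j)) := by
  simp [applyAt]

namespace YDData

/-- The action on `V^{⊗n}` of the standard generator `σᵢ` of the braid group:
`id ⊗ ⋯ ⊗ c_{V,V} ⊗ ⋯ ⊗ id`, the braiding at the positions `i, i + 1`. -/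
def sigma (D : YDData k H V) {n : ℕ} (i : SymmGroup.Idx n) : Module.End k (⨂[k]^n V) :=
  applyAt (D.braiding D) i.left i.right (by simp [SymmGroup.Idx.left, SymmGroup.Idx.right])

/-- The action on `V^{⊗n}` of the lift `s(w) = σ_{i₁} ⋯ σ_{iⱼ}` of a permutation
`w = τ_{i₁} ⋯ τ_{iⱼ}` to the braid group, where the word is of minimal length. -/
def braidLift (D : YDData k H V) {n : ℕ} (w : Equiv.Perm (Fin n)) : Module.End k (⨂[k]^n V) :=
  ((SymmGroup.reducedWord w).map D.sigma).prod

/-- `𝔖ⁿ = ∑_{w ∈ Sₙ} s(w)`. -/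
def symmetrizer (D : YDData k H V) (n : ℕ) : Module.End k (⨂[k]^n V) :=
  ∑ w : Equiv.Perm (Fin n), D.braidLift w

/-- The quantum symmetrizer `𝔖 = ⨁ₙ 𝔖ⁿ` on the tensor algebra. -/
def quantumSymmetrizer (D : YDData k H V) : TensorAlgebra k V →ₗ[k] ⨁ n, ⨂[k]^n V :=
  DirectSum.lmap D.symmetrizer ∘ₗ TensorAlgebra.equivDirectSum.toLinearMap

end YDData

end Symmetrizer

/-! ### The braided bialgebra `A(V)` and `𝔅(V)` -/

section TensorAlg

variable {k H V : Type*} [Field k] [Ring H] [HopfAlgebra k H] [AddCommGroup V] [Module k V]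

namespace YDData

/-- `x ↦ (h ↦ h • x)` for the diagonal action of `H` on the tensor algebra: the algebra map into
the convolution algebra `Hom(H, T(V))` extending the action on `V`; that is,
`h • (x y) = (h₍₁₎ • x) (h₍₂₎ • y)` and `h • 1 = ε(h)`. -/
def tensorAlgebraOrbit (D : YDData k H V) :
    TensorAlgebra k V →ₐ[k] WithConv (H →ₗ[k] TensorAlgebra k V) :=
  TensorAlgebra.lift k ((WithConv.linearEquiv k (H →ₗ[k] TensorAlgebra k V)).symm.toLinearMap ∘ₗ
    LinearMap.llcomp k H V (TensorAlgebra k V) (TensorAlgebra.ι k) ∘ₗ D.act.flip)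

/-- The Yetter–Drinfeld structure on `T(V) = ⨁ₙ V^{⊗n}`: diagonal action and coaction
(the latter is the algebra map `T(V) → H ⊗ T(V)` extending the coaction of `V`). -/
def tensorAlgebra (D : YDData k H V) : YDData k H (TensorAlgebra k V) where
  act := ((WithConv.linearEquiv k (H →ₗ[k] TensorAlgebra k V)).toLinearMap ∘ₗ
    D.tensorAlgebraOrbit.toLinearMap).flip
  coact := (TensorAlgebra.lift k ((TensorAlgebra.ι k).lTensor H ∘ₗ D.coact)).toLinearMap

/-- The algebra map `A(V) → End(A(V) ⊗ A(V))` sending `v` to the left multiplication by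
`v ⊗ 1 + 1 ⊗ v` in the braided tensor product algebra. -/
def tensorAlgebraComulAux (D : YDData k H V) :
    TensorAlgebra k V →ₐ[k] Module.End k (TensorAlgebra k V ⊗[k] TensorAlgebra k V) :=
  TensorAlgebra.lift k (TensorProduct.curry D.tensorAlgebra.braidedMul ∘ₗ
    ((TensorProduct.mk k _ _).flip 1 + TensorProduct.mk k _ _ 1) ∘ₗ TensorAlgebra.ι k)

/-- The comultiplication of `A(V)`: the algebra map into the braided tensor product algebra
`A(V) ⊗ A(V)` with `Δ(v) = v ⊗ 1 + 1 ⊗ v` for `v ∈ V`. -/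
def tensorAlgebraComul (D : YDData k H V) :
    TensorAlgebra k V →ₗ[k] TensorAlgebra k V ⊗[k] TensorAlgebra k V :=
  LinearMap.applyₗ (1 ⊗ₜ 1) ∘ₗ D.tensorAlgebraComulAux.toLinearMap

/-- `𝔅(V) = A(V) / ker 𝔖`. -/
abbrev NicholsAlgebra (D : YDData k H V) : Type _ :=
  TensorAlgebra k V ⧸ LinearMap.ker D.quantumSymmetrizer

/-- The quotient map `A(V) → 𝔅(V)`. -/
abbrev toNichols (D : YDData k H V) : TensorAlgebra k V →ₗ[k] D.NicholsAlgebra :=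
  (LinearMap.ker D.quantumSymmetrizer).mkQ

/-- `φ : 𝔅(V) ≃ R` is an isomorphism of graded Hopf algebras in the Yetter–Drinfeld category,
where the structure maps of `𝔅(V)` are those induced by `A(V)`: they are written on
representatives `x ∈ A(V)`. -/
structure IsNicholsIso {R : Type*} [Ring R] [Algebra k R] [Coalgebra k R] (D : YDData k H V)
    (DR : YDData k H R) (𝒜 : ℕ → Submodule k R) (φ : D.NicholsAlgebra ≃ₗ[k] R) : Prop where
  map_one : φ (D.toNichols 1) = 1
  map_mul : ∀ x y, φ (D.toNichols (x * y)) = φ (D.toNichols x) * φ (D.toNichols y)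
  map_counit : ∀ x, Coalgebra.counit (R := k) (φ (D.toNichols x)) =
    TensorAlgebra.algebraMapInv x
  map_comul : ∀ x, Coalgebra.comul (R := k) (φ (D.toNichols x)) =
    TensorProduct.map (φ.toLinearMap ∘ₗ D.toNichols) (φ.toLinearMap ∘ₗ D.toNichols)
      (D.tensorAlgebraComul x)
  map_yetterDrinfeld : D.tensorAlgebra.IsHom DR (φ.toLinearMap ∘ₗ D.toNichols)
  map_grading : ∀ n, Submodule.map (φ.toLinearMap ∘ₗ D.toNichols)
    (LinearMap.range (TensorAlgebra.ι k : V →ₗ[k] TensorAlgebra k V) ^ n) = 𝒜 n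

end YDData

/-- `F : R ≃ R'` is an isomorphism of graded Hopf algebras in the Yetter–Drinfeld category. -/
structure IsGradedBraidedHopfIso {R R' : Type*} [Ring R] [Algebra k R] [Coalgebra k R]
    [Ring R'] [Algebra k R'] [Coalgebra k R'] (D : YDData k H R) (𝒜 : ℕ → Submodule k R)
    (D' : YDData k H R') (𝒜' : ℕ → Submodule k R') (F : R ≃ₐ[k] R') : Prop where
  map_counit : ∀ x, Coalgebra.counit (R := k) (F x) = Coalgebra.counit (R := k) x
  map_comul : ∀ x, Coalgebra.comul (R := k) (F x) =
    TensorProduct.map F.toLinearMap F.toLinearMap (Coalgebra.comul (R := k) x)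
  map_yetterDrinfeld : D.IsHom D' F.toLinearMap
  map_grading : ∀ n, Submodule.map F.toLinearMap (𝒜 n) = 𝒜' n

end TensorAlg

end

/-!
Let `π : R → R(1) = V` be the projection and `∂ = (π ⊗ id) Δ : R → V ⊗ R`. Since `Δ` is
multiplicative for the braided product, `∂` obeys the Leibniz rule
`∂ (v x) = v ⊗ x + (id ⊗ μ) (c ⊗ id) (v ⊗ ∂ x)`, so the `n`-fold iterate of `∂` composed with
`V^{⊗n} → R(n)` is `𝔖ⁿ`, by the factorisation
`𝔖ⁿ⁺¹ = (id ⊗ 𝔖ⁿ) (1 + σ₀ + σ₀ σ₁ + ⋯ + σ₀ ⋯ σₙ₋₁)` coming from the minimal representatives of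
the cosets of `Sₙ` in `Sₙ₊₁`. By induction on `n ≥ 2`, an `x ∈ R(n)` with `∂ x = 0` is primitive,
hence zero: the iterates are injective, so `R(n) = V^{⊗n} / ker 𝔖ⁿ`, which depends on `V` alone.
-/

namespace SymmGroup

variable {n : ℕ} {M : Type*}

theorem Idx.left_lt_right (i : Idx n) : i.left < i.right :=
  Nat.lt_succ_self _

/-- The relations of the braid group between elements `σ i` indexed by the elementary
transpositions. -/
structure BraidRelations [Mul M] (σ : Idx n → M) : Prop where
  comm : ∀ i j : Idx n, i.1 + 1 < j.1 → σ i * σ j = σ j * σ i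
  braid : ∀ i j : Idx n, i.1 + 1 = j.1 → σ i * σ j * σ i = σ j * σ i * σ j

/-- The elementary transposition `τ_i = (i, i + 1)`. -/
abbrev transposition (i : Idx n) : Equiv.Perm (Fin n) :=
  Equiv.swap i.left i.right

theorem wordPerm_eq_prod (l : List (Idx n)) : wordPerm l = (l.map transposition).prod :=
  rfl

theorem braidRelations_transposition : BraidRelations (transposition (n := n)) where
  comm i j hij := by
    refine (Equiv.Perm.disjoint_swap_swap ?_).commute
    simp [Idx.left, Idx.right]
    omega
  braid i j hij := by
    have hji : j.left = i.right := Fin.ext hij.symm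
    have hi := i.left_lt_right
    have hj : i.right < j.right := hji ▸ j.left_lt_right
    rw [transposition, transposition, hji,
      Equiv.swap_mul_swap_mul_swap hi.ne (hi.trans hj).ne, Equiv.swap_comm i.left,
      Equiv.swap_comm i.right j.right,
      Equiv.swap_mul_swap_mul_swap hj.ne' (hi.trans hj).ne', Equiv.swap_comm]

/-- The inclusion `τ_i ↦ τ_{i+1}` of the elementary transpositions of `Fin n` into those of
`Fin (n + 1)`, fixing `0`. -/
def Idx.shift (i : Idx n) : Idx (n + 1) :=
  ⟨i.1 + 1, Nat.succ_lt_succ i.2⟩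

theorem BraidRelations.comp_shift [Mul M] {σ : Idx (n + 1) → M} (hσ : BraidRelations σ) :
    BraidRelations fun i : Idx n => σ i.shift where
  comm _ _ hij := hσ.comm _ _ (Nat.succ_lt_succ hij)
  braid _ _ hij := hσ.braid _ _ (congrArg (· + 1) hij)

theorem BraidRelations.of_comp_shift [Mul M] {σ : Idx (n + 1) → M}
    (hσ : BraidRelations fun i : Idx n => σ i.shift)
    (comm_zero : ∀ (h : 1 < n) (j : Idx (n - 1)),
      σ ⟨0, by omega⟩ * σ ⟨j + 2, by omega⟩ = σ ⟨j + 2, by omega⟩ * σ ⟨0, by omega⟩)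
    (braid_zero : ∀ h : 1 < n, σ ⟨0, by omega⟩ * σ ⟨1, by omega⟩ * σ ⟨0, by omega⟩ =
      σ ⟨1, by omega⟩ * σ ⟨0, by omega⟩ * σ ⟨1, by omega⟩) : BraidRelations σ where
  comm := by
    rintro ⟨_ | i, hi⟩ ⟨_ | _ | j, hj⟩ hij <;> dsimp only at hij
    · omega
    · omega
    · exact comm_zero (by omega) ⟨j, by omega⟩
    · omega
    · omega
    · exact hσ.comm ⟨i, by omega⟩ ⟨j + 1, by omega⟩ (Nat.lt_of_succ_lt_succ hij)
  braid := by
    rintro ⟨_ | i, hi⟩ ⟨_ | _ | j, hj⟩ hij <;> dsimp only at hij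
    · omega
    · exact braid_zero (by omega)
    · omega
    · omega
    · omega
    · exact hσ.braid ⟨i, by omega⟩ ⟨j + 1, by omega⟩ (Nat.succ.inj hij)

/-- The word `τ_0 τ_1 ⋯ τ_{i-1}`. The permutations of these words represent the right cosets in
`S_{n+1}` of the stabilizer of `0`. -/
def initialWord (i : Fin (n + 1)) : List (Idx (n + 1)) :=
  List.ofFn fun j : Fin i => ⟨j, by omega⟩

theorem initialWord_zero : initialWord (0 : Fin (n + 1)) = [] :=
  rfl

theorem initialWord_succ (i : Fin n) :
    initialWord i.succ = initialWord i.castSucc ++ [⟨i, by omega⟩] := by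
  rw [initialWord, List.ofFn_congr (Fin.val_succ i), List.ofFn_succ', List.concat_eq_append]
  rfl

theorem initialWord_succ_eq_cons (i : Fin (n + 1)) :
    initialWord i.succ = ⟨0, by omega⟩ :: (initialWord i).map Idx.shift := by
  simp [initialWord, List.ofFn_succ, List.map_ofFn, Function.comp_def, Idx.shift]

theorem length_initialWord (i : Fin (n + 1)) : (initialWord i).length = i := by
  simp [initialWord]

section Monoid

variable [Monoid M]

/-- The product of `σ` along `initialWord i`. -/
def initialProd (σ : Idx (n + 1) → M) (i : Fin (n + 1)) : M :=
  ((initialWord i).map σ).prod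

theorem initialProd_zero (σ : Idx (n + 1) → M) : initialProd σ 0 = 1 :=
  rfl

theorem initialProd_succ (σ : Idx (n + 1) → M) (i : Fin n) :
    initialProd σ i.succ = initialProd σ i.castSucc * σ ⟨i, by omega⟩ := by
  simp [initialProd, initialWord_succ]

theorem initialProd_succ_eq_mul (σ : Idx (n + 2) → M) (i : Fin (n + 1)) :
    initialProd σ i.succ = σ ⟨0, by omega⟩ * initialProd (fun j => σ j.shift) i := by
  simp [initialProd, initialWord_succ_eq_cons, Function.comp_def]

namespace BraidRelations

variable {σ : Idx (n + 1) → M}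

theorem initialProd_mul_of_lt (hσ : BraidRelations σ) {i : Fin (n + 1)} {j : Idx (n + 1)}
    (hij : i < j.1) : initialProd σ i * σ j = σ j * initialProd σ i := by
  induction i using Fin.induction with
  | zero => simp [initialProd_zero]
  | succ i ih =>
    rw [initialProd_succ, mul_assoc, hσ.comm _ j (by simpa using hij), ← mul_assoc,
      ih (Nat.lt_of_succ_lt hij), mul_assoc]

theorem initialProd_mul_of_add_one_lt (hσ : BraidRelations σ) {i : Fin (n + 1)} {j : Idx n}
    (hij : j.1 + 1 < i) :
    initialProd σ i * σ ⟨j, by omega⟩ = σ j.shift * initialProd σ i := by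
  induction i using Fin.induction with
  | zero => simp at hij
  | succ i ih =>
    rw [Fin.val_succ, Nat.succ_lt_succ_iff] at hij
    rw [initialProd_succ, mul_assoc]
    rcases (Nat.succ_le_of_lt hij).lt_or_eq with hlt | heq
    · rw [← hσ.comm _ _ (by simpa using hlt), ← mul_assoc, ih hlt, mul_assoc]
    · obtain ⟨i, hi⟩ := i
      obtain rfl : j.1 + 1 = i := heq
      have hj : (⟨j.1 + 1, hi⟩ : Fin n).castSucc = (⟨j, Nat.lt_of_succ_lt hi⟩ : Fin n).succ := rfl
      rw [hj, initialProd_succ, mul_assoc, ← mul_assoc (σ _), hσ.braid _ _ rfl, ← mul_assoc,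
        ← mul_assoc, hσ.initialProd_mul_of_lt (Nat.lt_succ_self j.1)]
      simp only [mul_assoc]
      rfl

end BraidRelations

end Monoid

theorem initialProd_transposition_apply (i : Fin (n + 1)) :
    initialProd transposition i i = 0 := by
  induction i using Fin.induction with
  | zero => simp [initialProd_zero]
  | succ i ih =>
    rw [initialProd_succ, Equiv.Perm.mul_apply, ← ih]
    congr 1
    exact Equiv.swap_apply_right _ _

/-- The inclusion of `S_n` into `S_{n+1}` as the stabilizer of `0`. -/
def shiftPerm : Equiv.Perm (Fin n) →* Equiv.Perm (Fin (n + 1)) where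
  toFun u := Equiv.Perm.decomposeFin.symm (0, u)
  map_one' := by simp [Equiv.Perm.one_def]
  map_mul' u v := by
    ext a
    refine Fin.cases ?_ (fun b => ?_) a <;> simp

theorem shiftPerm_apply_zero (u : Equiv.Perm (Fin n)) : shiftPerm u 0 = 0 := by
  simp [shiftPerm]

theorem shiftPerm_transposition (i : Idx n) :
    shiftPerm (transposition i) = transposition i.shift := by
  ext a
  refine Fin.cases ?_ (fun b => ?_) a
  · simp [shiftPerm, Equiv.swap_apply_def, Fin.ext_iff, Idx.left, Idx.right, Idx.shift]
  · simp only [shiftPerm, MonoidHom.coe_mk, OneHom.coe_mk,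
      Equiv.Perm.decomposeFin_symm_apply_succ, Equiv.swap_self, Equiv.refl_apply,
      Equiv.swap_apply_def, Fin.ext_iff, Idx.left, Idx.right, Idx.shift, Fin.val_succ,
      Nat.add_right_cancel_iff]
    split_ifs <;> simp_all

theorem wordPerm_map_shift (l : List (Idx n)) :
    wordPerm (l.map Idx.shift) = shiftPerm (wordPerm l) := by
  simp [wordPerm_eq_prod, map_list_prod, Function.comp_def, shiftPerm_transposition]

theorem bijective_shiftPerm_mul_initialProd (n : ℕ) :
    Function.Bijective fun x : Equiv.Perm (Fin n) × Fin (n + 1) =>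
      shiftPerm x.1 * initialProd transposition x.2 := by
  rw [Fintype.bijective_iff_injective_and_card]
  constructor
  · rintro ⟨u, i⟩ ⟨u', i'⟩ h
    have preimage_zero (u : Equiv.Perm (Fin n)) (i : Fin (n + 1)) :
        (shiftPerm u * initialProd transposition i) i = 0 := by
      rw [Equiv.Perm.mul_apply, initialProd_transposition_apply, shiftPerm_apply_zero]
    simp only at h
    obtain rfl : i = i' := Equiv.injective _ ((preimage_zero u i).trans
      (h ▸ (preimage_zero u' i').symm))
    simpa [shiftPerm] using mul_right_cancel h
  · simp [Fintype.card_perm, Nat.factorial_succ, mul_comm]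

/-- The decomposition of `S_{n+1}` into right cosets of the stabilizer of `0`. -/
noncomputable def cosetEquiv (n : ℕ) :
    Equiv.Perm (Fin n) × Fin (n + 1) ≃ Equiv.Perm (Fin (n + 1)) :=
  Equiv.ofBijective _ (bijective_shiftPerm_mul_initialProd n)

theorem cosetEquiv_apply (u : Equiv.Perm (Fin n)) (i : Fin (n + 1)) :
    cosetEquiv n (u, i) = shiftPerm u * initialProd transposition i :=
  rfl

/-- The reduced word of a permutation obtained by decomposing it along the chain
`S_0 ⊂ S_1 ⊂ ⋯ ⊂ S_n` of stabilizers, with the coset representatives of `initialWord`. -/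
noncomputable def normalWord : {n : ℕ} → Equiv.Perm (Fin n) → List (Idx n)
  | 0, _ => []
  | n + 1, w =>
    (normalWord ((cosetEquiv n).symm w).1).map Idx.shift ++ initialWord ((cosetEquiv n).symm w).2

theorem normalWord_cosetEquiv (u : Equiv.Perm (Fin n)) (i : Fin (n + 1)) :
    normalWord (cosetEquiv n (u, i)) = (normalWord u).map Idx.shift ++ initialWord i := by
  simp [normalWord]

theorem normalWord_one : normalWord (1 : Equiv.Perm (Fin n)) = [] := by
  induction n with
  | zero => rfl
  | succ n ih =>
    have h : cosetEquiv n (1, 0) = 1 := by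
      rw [cosetEquiv_apply, initialProd_zero, map_one, mul_one]
    rw [← h, normalWord_cosetEquiv, ih, initialWord_zero, List.map_nil, List.append_nil]

theorem wordPerm_normalWord (w : Equiv.Perm (Fin n)) : wordPerm (normalWord w) = w := by
  induction n with
  | zero => exact Subsingleton.elim _ _
  | succ n ih =>
    obtain ⟨⟨u, i⟩, rfl⟩ := (cosetEquiv n).surjective w
    rw [normalWord_cosetEquiv, wordPerm_eq_prod, List.map_append, List.prod_append,
      ← wordPerm_eq_prod, wordPerm_map_shift, ih]
    rfl

theorem length_normalWord_cosetEquiv (u : Equiv.Perm (Fin n)) (i : Fin (n + 1)) :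
    (normalWord (cosetEquiv n (u, i))).length = (normalWord u).length + i := by
  simp [normalWord_cosetEquiv, length_initialWord]

section Monoid

variable [Monoid M]

/-- The product of `σ` along the normal word of a permutation. -/
noncomputable def normalProd (σ : Idx n → M) (w : Equiv.Perm (Fin n)) : M :=
  ((normalWord w).map σ).prod

theorem normalProd_cosetEquiv (σ : Idx (n + 1) → M) (u : Equiv.Perm (Fin n))
    (i : Fin (n + 1)) : normalProd σ (cosetEquiv n (u, i)) =
      normalProd (fun j => σ j.shift) u * initialProd σ i := by
  simp [normalProd, normalWord_cosetEquiv, initialProd, Function.comp_def]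

/-- Right multiplication by `τ_j` either lengthens the normal word of `w` by one, compatibly with
the lift `σ` of the elementary transpositions, or shortens it by one. -/
def IsNormalStep (σ : Idx n → M) (w : Equiv.Perm (Fin n)) (j : Idx n) : Prop :=
  ((normalWord (w * transposition j)).length = (normalWord w).length + 1 ∧
    normalProd σ (w * transposition j) = normalProd σ w * σ j) ∨
  (normalWord (w * transposition j)).length + 1 = (normalWord w).length

theorem IsNormalStep.of_initialProd_mul {σ : Idx (n + 1) → M} {u : Equiv.Perm (Fin n)}
    {i : Fin (n + 1)} {j : Idx (n + 1)} {j' : Idx n}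
    (h : IsNormalStep (fun j => σ j.shift) u j')
    (hτ : initialProd transposition i * transposition j =
      transposition j'.shift * initialProd transposition i)
    (hσ : initialProd σ i * σ j = σ j'.shift * initialProd σ i) :
    IsNormalStep σ (cosetEquiv n (u, i)) j := by
  have hmul : cosetEquiv n (u, i) * transposition j = cosetEquiv n (u * transposition j', i) := by
    rw [cosetEquiv_apply, cosetEquiv_apply, mul_assoc, hτ, ← mul_assoc, map_mul,
      shiftPerm_transposition]
  simp only [IsNormalStep, hmul, length_normalWord_cosetEquiv, normalProd_cosetEquiv]
  refine h.imp (fun h => ⟨by omega, ?_⟩) (fun h => by omega)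
  rw [h.2, mul_assoc, mul_assoc, hσ]

theorem BraidRelations.isNormalStep {σ : Idx n → M} (hσ : BraidRelations σ)
    (w : Equiv.Perm (Fin n)) (j : Idx n) : IsNormalStep σ w j := by
  induction n with
  | zero => exact absurd j.2 (Nat.not_lt_zero _)
  | succ n ih =>
    obtain ⟨⟨u, i⟩, rfl⟩ := (cosetEquiv n).surjective w
    have hτ := braidRelations_transposition (n := n + 1)
    have hj : j.1 < n := Nat.lt_of_succ_lt_succ j.2
    have mul_succ : cosetEquiv n (u, Fin.castSucc ⟨j, hj⟩) * transposition j =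
        cosetEquiv n (u, Fin.succ ⟨j, hj⟩) := by
      simp only [cosetEquiv_apply, initialProd_succ, mul_assoc]
    rcases lt_or_ge i.1 j.1 with hlt | hge
    · obtain ⟨j' | j', hj'⟩ := j
      · exact absurd hlt (Nat.not_lt_zero _)
      · exact (ih hσ.comp_shift u ⟨j', hj⟩).of_initialProd_mul (hτ.initialProd_mul_of_lt hlt)
          (hσ.initialProd_mul_of_lt hlt)
    rcases hge.eq_or_lt with heq | hgt
    · obtain rfl : i = Fin.castSucc ⟨j, hj⟩ := Fin.ext heq.symm
      simp only [IsNormalStep, mul_succ, length_normalWord_cosetEquiv, normalProd_cosetEquiv,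
        initialProd_succ, mul_assoc]
      simp [add_assoc]
    rcases (Nat.succ_le_of_lt hgt).eq_or_lt with heq | hfar
    · obtain rfl : i = Fin.succ ⟨j, hj⟩ := Fin.ext heq.symm
      rw [← mul_succ]
      simp only [IsNormalStep, mul_assoc, Equiv.swap_mul_self, mul_one]
      simp only [mul_succ, length_normalWord_cosetEquiv]
      exact .inr rfl
    · let j' : Idx n := ⟨j, by omega⟩
      exact (ih hσ.comp_shift u j').of_initialProd_mul
        (hτ.initialProd_mul_of_add_one_lt (j := j') hfar)
        (hσ.initialProd_mul_of_add_one_lt (j := j') hfar)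

theorem BraidRelations.length_normalWord_le_and_prod_eq {σ : Idx n → M} (hσ : BraidRelations σ)
    (l : List (Idx n)) : (normalWord (wordPerm l)).length ≤ l.length ∧
      ((normalWord (wordPerm l)).length = l.length →
        (l.map σ).prod = normalProd σ (wordPerm l)) := by
  induction l using List.reverseRecOn with
  | nil => simp [wordPerm_eq_prod, normalProd, normalWord_one]
  | append_singleton l j ih =>
    obtain ⟨hle, hprod⟩ := ih
    have hmul : wordPerm (l ++ [j]) = wordPerm l * transposition j := by
      simp [wordPerm_eq_prod]
    simp only [hmul, List.length_append, List.length_singleton, List.map_append, List.prod_append,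
      List.map_singleton, List.prod_singleton]
    rcases hσ.isNormalStep (wordPerm l) j with ⟨hlen, hstep⟩ | hlen
    · exact ⟨by omega, fun h => by rw [hstep, hprod (by omega)]⟩
    · exact ⟨by omega, fun h => by omega⟩

/-- Matsumoto's theorem for the symmetric group. -/
theorem BraidRelations.prod_eq_of_isReducedWord {σ : Idx n → M} (hσ : BraidRelations σ)
    {w : Equiv.Perm (Fin n)} {l : List (Idx n)} (hl : IsReducedWord w l) :
    (l.map σ).prod = normalProd σ w := by
  obtain ⟨rfl, hmin⟩ := hl
  obtain ⟨hle, hprod⟩ := hσ.length_normalWord_le_and_prod_eq l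
  exact hprod (hle.antisymm (hmin _ (wordPerm_normalWord _)))

end Monoid

theorem BraidRelations.sum_prod_reducedWord [Semiring M] {σ : Idx (n + 1) → M}
    (hσ : BraidRelations σ) :
    ∑ w, ((reducedWord w).map σ).prod =
      (∑ u, ((reducedWord u).map (fun i => σ i.shift)).prod) * ∑ i, initialProd σ i := by
  have prod_reducedWord {m : ℕ} {ρ : Idx m → M} (hρ : BraidRelations ρ) (w) :
      ((reducedWord w).map ρ).prod = normalProd ρ w :=
    hρ.prod_eq_of_isReducedWord (exists_reducedWord w).choose_spec
  simp only [prod_reducedWord hσ, prod_reducedWord hσ.comp_shift]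
  rw [← (cosetEquiv n).sum_comp, Fintype.sum_prod_type, Finset.sum_mul]
  simp only [normalProd_cosetEquiv, Finset.mul_sum]

end SymmGroup

/-! ### The Yang–Baxter equation -/

section YangBaxter

variable {R M N : Type*} [CommSemiring R] [AddCommMonoid M] [Module R M]
  [AddCommMonoid N] [Module R N]

/-- `c ⊗ id` on `M ⊗ (M ⊗ W)`, for an operator `c` on `M ⊗ M`. -/
def braidHead (c : M ⊗[R] M →ₗ[R] M ⊗[R] M) (W : Type*) [AddCommMonoid W] [Module R W] :
    M ⊗[R] (M ⊗[R] W) →ₗ[R] M ⊗[R] (M ⊗[R] W) :=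
  (TensorProduct.assoc R M M W).toLinearMap ∘ₗ c.rTensor W
    ∘ₗ (TensorProduct.assoc R M M W).symm.toLinearMap

theorem braidHead_tmul (c : M ⊗[R] M →ₗ[R] M ⊗[R] M) {W : Type*} [AddCommMonoid W] [Module R W]
    (a b : M) (w : W) :
    braidHead c W (a ⊗ₜ (b ⊗ₜ w)) = TensorProduct.assoc R M M W (c (a ⊗ₜ b) ⊗ₜ w) := by
  simp [braidHead]

theorem braidHead_map {c : M ⊗[R] M →ₗ[R] M ⊗[R] M} {d : N ⊗[R] N →ₗ[R] N ⊗[R] N}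
    {f : M →ₗ[R] N} (h : TensorProduct.map f f ∘ₗ c = d ∘ₗ TensorProduct.map f f)
    {W W' : Type*} [AddCommMonoid W] [Module R W] [AddCommMonoid W'] [Module R W']
    (g : W →ₗ[R] W') :
    braidHead d W' ∘ₗ TensorProduct.map f (TensorProduct.map f g) =
      TensorProduct.map f (TensorProduct.map f g) ∘ₗ braidHead c W := by
  refine TensorProduct.ext_threefold' fun x y w => ?_
  have hxy := LinearMap.congr_fun h (x ⊗ₜ y)
  simp only [LinearMap.comp_apply, TensorProduct.map_tmul, braidHead_tmul] at hxy ⊢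
  rw [← hxy, ← TensorProduct.map_tmul, TensorProduct.map_map_assoc]

theorem braidHead_comp_lTensor_lTensor (c : M ⊗[R] M →ₗ[R] M ⊗[R] M) {W W' : Type*}
    [AddCommMonoid W] [Module R W] [AddCommMonoid W'] [Module R W'] (g : W →ₗ[R] W') :
    braidHead c W' ∘ₗ (g.lTensor M).lTensor M = (g.lTensor M).lTensor M ∘ₗ braidHead c W :=
  braidHead_map (f := LinearMap.id) (by simp) g

/-- The Yang–Baxter equation `c₁ c₂ c₁ = c₂ c₁ c₂` on `M ⊗ M ⊗ M`. -/
def IsYangBaxter (c : M ⊗[R] M →ₗ[R] M ⊗[R] M) : Prop :=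
  braidHead c M ∘ₗ c.lTensor M ∘ₗ braidHead c M = c.lTensor M ∘ₗ braidHead c M ∘ₗ c.lTensor M

theorem assoc_tmul_eq_lTensor_mk_flip {W : Type*} [AddCommMonoid W] [Module R W]
    (t : M ⊗[R] N) (w : W) :
    TensorProduct.assoc R M N W (t ⊗ₜ w) = ((TensorProduct.mk R N W).flip w).lTensor M t := by
  induction t with
  | zero => simp
  | add t u ht hu => rw [TensorProduct.add_tmul, map_add, map_add, ht, hu]
  | tmul a b => simp

theorem IsYangBaxter.braidHead_lTensor_braidHead {c : M ⊗[R] M →ₗ[R] M ⊗[R] M}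
    (hc : IsYangBaxter c) (W : Type*) [AddCommMonoid W] [Module R W] :
    braidHead c (M ⊗[R] W) ∘ₗ (braidHead c W).lTensor M ∘ₗ braidHead c (M ⊗[R] W) =
      (braidHead c W).lTensor M ∘ₗ braidHead c (M ⊗[R] W) ∘ₗ (braidHead c W).lTensor M := by
  ext x y z w : 8
  let append : M ⊗[R] (M ⊗[R] M) →ₗ[R] M ⊗[R] (M ⊗[R] (M ⊗[R] W)) :=
    (((TensorProduct.mk R M W).flip w).lTensor M).lTensor M
  have braidHead_append (t) : braidHead c (M ⊗[R] W) (append t) = append (braidHead c M t) :=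
    LinearMap.congr_fun (braidHead_comp_lTensor_lTensor c _) t
  have lTensor_append (t) : (braidHead c W).lTensor M (append t) = append (c.lTensor M t) := by
    simp only [append, ← LinearMap.lTensor_comp_apply]
    congr 2
    ext a b
    simp [braidHead_tmul, assoc_tmul_eq_lTensor_mk_flip]
  have h := congrArg append (LinearMap.congr_fun hc (x ⊗ₜ (y ⊗ₜ z)))
  simp only [LinearMap.comp_apply, ← braidHead_append, ← lTensor_append] at h
  exact h

theorem IsYangBaxter.of_injective [Module.Flat R M] [Module.Flat R N]
    {c : M ⊗[R] M →ₗ[R] M ⊗[R] M} {d : N ⊗[R] N →ₗ[R] N ⊗[R] N}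
    (hd : IsYangBaxter d) {f : M →ₗ[R] N} (hf : Function.Injective f)
    (h : TensorProduct.map f f ∘ₗ c = d ∘ₗ TensorProduct.map f f) : IsYangBaxter c := by
  set F := TensorProduct.map f (TensorProduct.map f f)
  have hF : Function.Injective F :=
    TensorProduct.map_injective_of_flat_flat _ _ hf
      (TensorProduct.map_injective_of_flat_flat _ _ hf hf)
  have map_braidHead (z) : F (braidHead c M z) = braidHead d N (F z) :=
    (LinearMap.congr_fun (braidHead_map h f) z).symm
  have map_lTensor (z) : F (c.lTensor M z) = d.lTensor N (F z) := by
    simp only [F, LinearMap.lTensor, ← LinearMap.comp_apply, ← TensorProduct.map_comp, h,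
      LinearMap.comp_id, LinearMap.id_comp]
  refine LinearMap.ext fun x => hF ?_
  simp only [LinearMap.comp_apply, map_braidHead, map_lTensor]
  exact LinearMap.congr_fun hd (F x)

end YangBaxter

/-! ### The braiding of Yetter–Drinfeld modules -/

namespace YDData

variable {k H M N P : Type*} [Field k] [Ring H] [HopfAlgebra k H]
  [AddCommGroup M] [Module k M] [AddCommGroup N] [Module k N] [AddCommGroup P] [Module k P]

theorem braiding_tmul (D : YDData k H M) (D' : YDData k H N) (m : M) (n : N) :
    D.braiding D' (m ⊗ₜ n) = (D'.act.flip n).rTensor M (D.coact m) := by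
  simp only [braiding, LinearMap.comp_apply, LinearMap.rTensor_tmul, LinearEquiv.coe_coe]
  generalize D.coact m = t
  induction t with
  | zero => simp
  | add x y hx hy => simp only [TensorProduct.add_tmul, map_add, hx, hy]
  | tmul h m => simp

theorem tensor_act_tmul (D : YDData k H M) (D' : YDData k H N) (h : H) (m : M) (n : N) :
    (D.tensor D').act h (m ⊗ₜ n) =
      TensorProduct.map (D.act.flip m) (D'.act.flip n) (Coalgebra.comul (R := k) h) := by
  simp only [tensor, LinearMap.comp_apply]
  generalize Coalgebra.comul (R := k) h = t
  induction t with
  | zero => simp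
  | add x y hx hy => simp only [map_add, LinearMap.add_apply, hx, hy]
  | tmul h m => simp

theorem tensor_coact_tmul (D : YDData k H M) (D' : YDData k H N) (m : M) (n : N) :
    (D.tensor D').coact (m ⊗ₜ n) = (LinearMap.mul' k H).rTensor (M ⊗[k] N)
      (TensorProduct.tensorTensorTensorComm k H M H N (D.coact m ⊗ₜ D'.coact n)) := by
  simp [tensor]

theorem braiding_lTensor (D : YDData k H M) {D' : YDData k H N} {D'' : YDData k H P}
    {f : N →ₗ[k] P} (hf : ∀ h n, f (D'.act h n) = D''.act h (f n)) :
    D.braiding D'' ∘ₗ f.lTensor M = f.rTensor M ∘ₗ D.braiding D' := by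
  ext m n
  simp only [TensorProduct.AlgebraTensorModule.curry_apply, TensorProduct.curry_apply,
    LinearMap.coe_restrictScalars, LinearMap.comp_apply, LinearMap.lTensor_tmul, braiding_tmul,
    ← LinearMap.rTensor_comp_apply]
  congr 2
  ext h
  simp [hf]

theorem IsHom.map_comp_braiding {D : YDData k H M} {D' : YDData k H N} {f : M →ₗ[k] N}
    (hf : D.IsHom D' f) :
    TensorProduct.map f f ∘ₗ D.braiding D = D'.braiding D' ∘ₗ TensorProduct.map f f := by
  ext m n
  simp only [TensorProduct.AlgebraTensorModule.curry_apply, TensorProduct.curry_apply,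
    LinearMap.coe_restrictScalars, LinearMap.comp_apply, TensorProduct.map_tmul, braiding_tmul,
    hf.map_coact]
  generalize D.coact m = t
  induction t with
  | zero => simp
  | add x y hx hy => simp only [map_add, hx, hy]
  | tmul h m => simp [hf.map_act]

/-- The inclusion `h ↦ h ⊗ 1` into `H ⊗ End M`. -/
abbrev includeLeft (k H M : Type*) [Field k] [Ring H] [HopfAlgebra k H] [AddCommGroup M]
    [Module k M] : H →ₐ[k] H ⊗[k] Module.End k M :=
  Algebra.TensorProduct.includeLeft

/-- `h ↦ h g ⊗ 1` in the convolution algebra `Hom(H, H ⊗ End M)`. -/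
def convMulRight (M : Type*) [AddCommGroup M] [Module k M] (g : H) :
    WithConv (H →ₗ[k] H ⊗[k] Module.End k M) :=
  WithConv.toConv ((includeLeft k H M).toLinearMap ∘ₗ LinearMap.mulRight k g)

/-- `h ↦ 1 ⊗ (m ↦ h • m)` in the convolution algebra `Hom(H, H ⊗ End M)`. -/
def convAct (D : YDData k H M) : WithConv (H →ₗ[k] H ⊗[k] Module.End k M) :=
  WithConv.toConv (TensorProduct.mk k H (Module.End k M) 1 ∘ₗ D.act)

open WithConv in
theorem conv_mul_antipode_mul_cancel {A : Type*} [Semiring A] [Algebra k A] (ι : H →ₐ[k] A)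
    (f g : WithConv (H →ₗ[k] A)) :
    f * (g * toConv (ι.toLinearMap ∘ₗ HopfAlgebra.antipode k)) * toConv ι.toLinearMap = f * g := by
  have antipode_mul :
      toConv (ι.toLinearMap ∘ₗ HopfAlgebra.antipode k) * toConv ι.toLinearMap = 1 := by
    have h := LinearMap.algHom_comp_convMul_distrib ι
      (toConv (HopfAlgebra.antipode k (A := H))) (toConv LinearMap.id)
    rw [LinearMap.antipode_mul_id] at h
    refine ofConv_injective (h.symm.trans ?_)
    ext x
    simp
  rw [mul_assoc, mul_assoc, antipode_mul, mul_one]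

open WithConv in
/-- `h ↦ h₁ g S(h₃) ⊗ h₂` is a product in the convolution algebra `Hom(H, H ⊗ End M)`, in which
coassociativity becomes associativity. -/
theorem twistedAct_tmul (D : YDData k H M) (h g : H) (m : M) :
    D.twistedAct h (g ⊗ₜ m) = (LinearMap.applyₗ m).lTensor H
      ((convMulRight M g * (D.convAct * toConv ((includeLeft k H M).toLinearMap ∘ₗ
        HopfAlgebra.antipode k)) : WithConv (H →ₗ[k] H ⊗[k] Module.End k M)) h) := by
  rw [LinearMap.convMul_apply]
  simp only [twistedAct, LinearMap.comp_apply]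
  generalize Coalgebra.comul (R := k) h = t
  induction t with
  | zero => simp
  | add x y hx hy => simp only [map_add, LinearMap.add_apply, hx, hy]
  | tmul a b =>
    rw [TensorProduct.map_tmul]
    simp only [LinearMap.lTensor_tmul, LinearMap.convMul_def, LinearMap.comp_apply]
    generalize Coalgebra.comul (R := k) b = t
    induction t with
    | zero => simp
    | add x y hx hy =>
      simp only [TensorProduct.tmul_add, map_add, LinearMap.add_apply, hx, hy]
    | tmul b c => simp [mulAntipode, convMulRight, convAct, mul_assoc]

open WithConv in
/-- In `h₁ g S(h₃) h₄ ⊗ h₂ m` the factor `S(h₃) h₄` cancels. -/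
theorem twistedAct_mul_cancel (D : YDData k H M) (h g : H) (m : M) :
    (TensorProduct.lift (LinearMap.mul k H).flip).rTensor M
        ((TensorProduct.assoc k H H M).symm ((D.twistedAct.flip (g ⊗ₜ m)).lTensor H
          (TensorProduct.comm k H H (Coalgebra.comul (R := k) h)))) =
      (LinearMap.applyₗ m).lTensor H ((convMulRight M g * D.convAct :
        WithConv (H →ₗ[k] H ⊗[k] Module.End k M)) h) := by
  rw [← conv_mul_antipode_mul_cancel (includeLeft k H M), LinearMap.convMul_apply]
  generalize Coalgebra.comul (R := k) h = s
  induction s with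
  | zero => simp
  | add s t hs ht => simp only [map_add, hs, ht]
  | tmul x y =>
    rw [TensorProduct.map_tmul, TensorProduct.comm_tmul, LinearMap.lTensor_tmul,
      LinearMap.flip_apply, twistedAct_tmul]
    generalize (convMulRight M g * (D.convAct * toConv ((includeLeft k H M).toLinearMap ∘ₗ
      HopfAlgebra.antipode k)) : WithConv (H →ₗ[k] H ⊗[k] Module.End k M)) x = z
    simp only [AlgHom.toLinearMap_apply]
    induction z with
    | zero => simp
    | add z w hz hw =>
      simp only [map_add, TensorProduct.tmul_add, TensorProduct.add_tmul, hz, hw]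
    | tmul x z => simp

/-- The antipode-free form `h₁ m₋₁ ⊗ h₂ m₀ = (h₁ m)₋₁ h₂ ⊗ (h₁ m)₀` of the Yetter–Drinfeld
condition. -/
theorem IsYetterDrinfeld.map_mul_act_coact {D : YDData k H M} (hD : D.IsYetterDrinfeld)
    (h : H) (m : M) :
    TensorProduct.homTensorHomMap (.id k) H M H M
        (TensorProduct.map (LinearMap.mul k H) D.act (Coalgebra.comul (R := k) h)) (D.coact m) =
      (TensorProduct.lift (LinearMap.mul k H).flip).rTensor M
        ((TensorProduct.assoc k H H M).symm ((D.coact ∘ₗ D.act.flip m).lTensor H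
          (TensorProduct.comm k H H (Coalgebra.comul (R := k) h)))) := by
  have coact_act : D.coact ∘ₗ D.act.flip m = D.twistedAct.flip (D.coact m) :=
    LinearMap.ext fun x => hD.coact_act x m
  rw [coact_act]
  generalize D.coact m = t
  induction t with
  | zero => simp
  | add s t hs ht =>
    simp only [map_add, LinearMap.add_apply, LinearMap.lTensor_add, hs, ht]
  | tmul g m =>
    rw [twistedAct_mul_cancel, LinearMap.convMul_apply]
    generalize Coalgebra.comul (R := k) h = s
    induction s with
    | zero => simp
    | add s t hs ht => simp only [map_add, LinearMap.add_apply, hs, ht]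
    | tmul x y => simp [convMulRight, convAct]

theorem IsYetterDrinfeld.braiding_act {D : YDData k H M} (hD : D.IsYetterDrinfeld)
    {D' : YDData k H N} (hD' : ∀ g h : H, D'.act (g * h) = D'.act g * D'.act h) (h : H)
    (z : M ⊗[k] N) :
    D.braiding D' ((D.tensor D').act h z) = (D'.tensor D).act h (D.braiding D' z) := by
  induction z with
  | zero => simp
  | add x y hx hy => simp only [map_add, hx, hy]
  | tmul m n =>
    have tensor_act_rTensor (t : H ⊗[k] M) :
        (D'.tensor D).act h ((D'.act.flip n).rTensor M t) = (D'.act.flip n).rTensor M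
          (TensorProduct.homTensorHomMap (.id k) H M H M
            (TensorProduct.map (LinearMap.mul k H) D.act (Coalgebra.comul (R := k) h)) t) := by
      induction t with
      | zero => simp
      | add x y hx hy => simp only [map_add, hx, hy]
      | tmul g m =>
        rw [LinearMap.rTensor_tmul, LinearMap.flip_apply, tensor_act_tmul]
        generalize Coalgebra.comul (R := k) h = s
        induction s with
        | zero => simp
        | add x y hx hy => simp only [map_add, LinearMap.add_apply, hx, hy]
        | tmul x y => simp [hD']
    rw [braiding_tmul, tensor_act_rTensor, hD.map_mul_act_coact, tensor_act_tmul]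
    generalize Coalgebra.comul (R := k) h = s
    induction s with
    | zero => simp
    | add x y hx hy => simp only [map_add, hx, hy]
    | tmul x y =>
      simp only [TensorProduct.map_tmul, TensorProduct.comm_tmul, LinearMap.lTensor_tmul,
        LinearMap.comp_apply, LinearMap.flip_apply, braiding_tmul]
      generalize D.coact (D.act x m) = t
      induction t with
      | zero => simp
      | add x y hx hy => simp only [map_add, TensorProduct.tmul_add, hx, hy]
      | tmul g m => simp [hD']

theorem IsYetterDrinfeld.braiding_hexagon {D : YDData k H M}
    (hD : D.IsYetterDrinfeld) (D' : YDData k H N) (D'' : YDData k H P) :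
    (D.braiding D'').lTensor N ∘ₗ (TensorProduct.assoc k N M P).toLinearMap ∘ₗ
        (D.braiding D').rTensor P =
      (TensorProduct.assoc k N P M).toLinearMap ∘ₗ D.braiding (D'.tensor D'') ∘ₗ
        (TensorProduct.assoc k M N P).toLinearMap := by
  ext m n p
  have lTensor_braiding (t : H ⊗[k] M) : (D.braiding D'').lTensor N
      (TensorProduct.assoc k N M P ((D'.act.flip n).rTensor M t ⊗ₜ p)) =
      TensorProduct.map (D'.act.flip n) ((D''.act.flip p).rTensor M) (D.coact.lTensor H t) := by
    induction t with
    | zero => simp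
    | add x y hx hy => simp only [map_add, TensorProduct.add_tmul, hx, hy]
    | tmul x y => simp [braiding_tmul]
  simp only [TensorProduct.AlgebraTensorModule.curry_apply, TensorProduct.curry_apply,
    LinearMap.coe_restrictScalars, LinearMap.comp_apply, LinearMap.rTensor_tmul,
    LinearEquiv.coe_coe, TensorProduct.assoc_tmul, braiding_tmul, lTensor_braiding]
  rw [← LinearMap.comp_apply (LinearMap.lTensor H _), ← hD.coassoc]
  simp only [LinearMap.comp_apply]
  generalize D.coact m = t
  induction t with
  | zero => simp
  | add x y hx hy => simp only [map_add, hx, hy]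
  | tmul h m =>
    simp only [LinearMap.rTensor_tmul, LinearMap.flip_apply, tensor_act_tmul]
    generalize Coalgebra.comul (R := k) h = s
    induction s with
    | zero => simp
    | add x y hx hy => simp only [map_add, TensorProduct.add_tmul, hx, hy]
    | tmul x y => simp

/-- The Yang–Baxter equation is the naturality of `c_{M, -}` at the `H`-linear map
`c_{M, M} : M ⊗ M → M ⊗ M`. -/
theorem IsYetterDrinfeld.isYangBaxter {D : YDData k H M} (hD : D.IsYetterDrinfeld) :
    IsYangBaxter (D.braiding D) := by
  have hexagon (z) : (D.braiding D).lTensor M (braidHead (D.braiding D) M z) =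
      TensorProduct.assoc k M M M (D.braiding (D.tensor D) z) := by
    simpa [braidHead] using LinearMap.congr_fun (hD.braiding_hexagon D D)
      ((TensorProduct.assoc k M M M).symm z)
  have naturality := D.braiding_lTensor (hD.braiding_act hD.act_mul)
  refine LinearMap.ext fun z => ?_
  have h := LinearMap.congr_fun naturality z
  simp only [LinearMap.comp_apply] at h ⊢
  rw [hexagon, hexagon, h, braidHead]
  simp

end YDData

/-! ### Braid operators on tensor powers -/

section TensorCons

variable (R M : Type*) [CommSemiring R] [AddCommMonoid M] [Module R M]

/-- The isomorphism `M ⊗ M^{⊗n} ≃ M^{⊗(n+1)}`. -/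
def tensorCons (n : ℕ) : M ⊗[R] (⨂[R]^n M) ≃ₗ[R] ⨂[R]^(n + 1) M :=
  ((PiTensorProduct.subsingletonEquiv (R := R) (s := fun _ : Fin 1 => M)
      (0 : Fin 1)).symm.rTensor (⨂[R]^n M)).trans
    (TensorPower.mulEquiv.trans (TensorPower.cast R M (Nat.add_comm 1 n)))

/-- The isomorphism `M ⊗ (M ⊗ M^{⊗n}) ≃ M^{⊗(n+2)}`. -/
def tensorConsCons (n : ℕ) : M ⊗[R] (M ⊗[R] (⨂[R]^n M)) ≃ₗ[R] ⨂[R]^(n + 2) M :=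
  ((tensorCons R M n).lTensor M).trans (tensorCons R M (n + 1))

variable {R M}

theorem tensorCons_tprod {n : ℕ} (v : M) (w : Fin n → M) :
    tensorCons R M n (v ⊗ₜ PiTensorProduct.tprod R w) = PiTensorProduct.tprod R (Fin.cons v w) := by
  rw [tensorCons, LinearEquiv.trans_apply, LinearEquiv.rTensor_tmul,
    PiTensorProduct.subsingletonEquiv_symm_apply, LinearEquiv.trans_apply, ← TensorPower.gMul_def,
    TensorPower.tprod_mul_tprod, TensorPower.cast_tprod, Fin.append_left_eq_cons]
  rfl

theorem tensorConsCons_apply {n : ℕ} (x : M ⊗[R] (M ⊗[R] (⨂[R]^n M))) :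
    tensorConsCons R M n x =
      tensorCons R M (n + 1) ((tensorCons R M n).toLinearMap.lTensor M x) :=
  rfl

/-- The endomorphism `id ⊗ f` of `M^{⊗(n+1)}`. -/
def shiftEnd (n : ℕ) : Module.End R (⨂[R]^n M) →ₐ[R] Module.End R (⨂[R]^(n + 1) M) :=
  ((tensorCons R M n).conjAlgEquiv R).toAlgHom.comp (Module.End.lTensorAlgHom R _ M)

theorem shiftEnd_tensorCons {n : ℕ} (f : Module.End R (⨂[R]^n M)) (x : M ⊗[R] (⨂[R]^n M)) :
    shiftEnd n f (tensorCons R M n x) = tensorCons R M n (f.lTensor M x) := by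
  change tensorCons R M n (f.lTensor M ((tensorCons R M n).symm (tensorCons R M n x))) = _
  rw [LinearEquiv.symm_apply_apply]

theorem shiftEnd_tensorConsCons {n : ℕ} {f : Module.End R (⨂[R]^(n + 1) M)}
    {g : Module.End R (M ⊗[R] (⨂[R]^n M))}
    (h : ∀ x, f (tensorCons R M n x) = tensorCons R M n (g x)) (x : M ⊗[R] (M ⊗[R] (⨂[R]^n M))) :
    shiftEnd (n + 1) f (tensorConsCons R M n x) = tensorConsCons R M n (g.lTensor M x) := by
  have h' : f ∘ₗ (tensorCons R M n).toLinearMap = (tensorCons R M n).toLinearMap ∘ₗ g :=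
    LinearMap.ext h
  rw [tensorConsCons_apply, tensorConsCons_apply, shiftEnd_tensorCons,
    ← LinearMap.lTensor_comp_apply, ← LinearMap.lTensor_comp_apply, h']

end TensorCons

section Sigma

open SymmGroup

variable {k H V : Type*} [Field k] [Ring H] [HopfAlgebra k H] [AddCommGroup V] [Module k V]

theorem insertPair_succ_succ {n : ℕ} {i j : Fin n} (hij : i ≠ j) (v : V) (w : Fin n → V)
    (z : V ⊗[k] V) :
    insertPair i.succ j.succ ((Fin.succ_injective n).ne hij) (Fin.cons v w) z =
      tensorCons k V n (v ⊗ₜ insertPair i j hij w z) := by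
  induction z with
  | zero => simp only [map_zero, TensorProduct.tmul_zero]
  | add x y hx hy => simp only [map_add, TensorProduct.tmul_add, hx, hy]
  | tmul a b => simp only [insertPair_tmul, tensorCons_tprod, Fin.cons_update]

theorem insertPair_zero_one {n : ℕ} (a b : V) (w : Fin n → V) (z : V ⊗[k] V) :
    insertPair 0 (Fin.succ 0) (Fin.succ_ne_zero 0).symm
        (Fin.cons a (Fin.cons b w) : Fin (n + 2) → V) z =
      tensorConsCons k V n
        (TensorProduct.assoc k V V (⨂[k]^n V) (z ⊗ₜ PiTensorProduct.tprod k w)) := by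
  induction z with
  | zero => simp only [map_zero, TensorProduct.zero_tmul]
  | add x y hx hy => simp only [map_add, TensorProduct.add_tmul, hx, hy]
  | tmul x y =>
    simp only [insertPair_tmul, TensorProduct.assoc_tmul, tensorConsCons_apply,
      LinearMap.lTensor_tmul, LinearEquiv.coe_coe, tensorCons_tprod, Fin.update_cons_zero,
      ← Fin.cons_update]

namespace YDData

theorem sigma_tprod (D : YDData k H V) {n : ℕ} (i : Idx n) (v : Fin n → V) :
    D.sigma i (PiTensorProduct.tprod k v) =
      insertPair i.left i.right i.left_lt_right.ne v (D.braiding D (v i.left ⊗ₜ v i.right)) :=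
  applyAt_tprod _ _ _ _ _

theorem sigma_shift (D : YDData k H V) {n : ℕ} (i : Idx n) :
    D.sigma i.shift = shiftEnd n (D.sigma i) := by
  suffices D.sigma i.shift ∘ₗ (tensorCons k V n).toLinearMap =
      (tensorCons k V n).toLinearMap ∘ₗ (D.sigma i).lTensor V by
    refine LinearMap.ext fun t => ?_
    obtain ⟨x, rfl⟩ := (tensorCons k V n).surjective t
    rw [shiftEnd_tensorCons]
    exact LinearMap.congr_fun this x
  ext v w
  simp only [TensorProduct.AlgebraTensorModule.curry_apply, TensorProduct.curry_apply,
    LinearMap.coe_restrictScalars, LinearMap.compMultilinearMap_apply, LinearMap.comp_apply,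
    LinearEquiv.coe_coe, LinearMap.lTensor_tmul, tensorCons_tprod, sigma_tprod]
  simp only [show i.shift.left = i.left.succ from rfl, show i.shift.right = i.right.succ from rfl,
    Fin.cons_succ]
  exact insertPair_succ_succ i.left_lt_right.ne v w _

theorem sigma_zero (D : YDData k H V) {n : ℕ} (x : V ⊗[k] (V ⊗[k] (⨂[k]^n V))) :
    D.sigma (⟨0, by omega⟩ : Idx (n + 2)) (tensorConsCons k V n x) =
      tensorConsCons k V n (braidHead (D.braiding D) _ x) := by
  suffices D.sigma (⟨0, by omega⟩ : Idx (n + 2)) ∘ₗ (tensorConsCons k V n).toLinearMap =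
      (tensorConsCons k V n).toLinearMap ∘ₗ braidHead (D.braiding D) _ from
    LinearMap.congr_fun this x
  ext a b w
  simp only [TensorProduct.AlgebraTensorModule.curry_apply, TensorProduct.curry_apply,
    LinearMap.coe_restrictScalars, LinearMap.compMultilinearMap_apply, LinearMap.comp_apply,
    LinearEquiv.coe_coe, braidHead_tmul]
  rw [← insertPair_zero_one a b w, tensorConsCons_apply, LinearMap.lTensor_tmul,
    LinearEquiv.coe_coe, tensorCons_tprod, tensorCons_tprod, sigma_tprod]
  rfl

theorem sigma_zero_mul_shiftEnd_shiftEnd (D : YDData k H V) {n : ℕ}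
    (f : Module.End k (⨂[k]^n V)) :
    D.sigma (⟨0, by omega⟩ : Idx (n + 2)) * shiftEnd (n + 1) (shiftEnd n f) =
      shiftEnd (n + 1) (shiftEnd n f) * D.sigma (⟨0, by omega⟩ : Idx (n + 2)) := by
  refine LinearMap.ext fun t => ?_
  obtain ⟨x, rfl⟩ := (tensorConsCons k V n).surjective t
  simp only [Module.End.mul_apply, shiftEnd_tensorConsCons (shiftEnd_tensorCons f), sigma_zero]
  exact congrArg _ (LinearMap.congr_fun (braidHead_comp_lTensor_lTensor (D.braiding D) f) x)

theorem sigma_zero_mul_sigma_one_mul_sigma_zero {D : YDData k H V}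
    (hD : IsYangBaxter (D.braiding D)) (n : ℕ) :
    D.sigma (⟨0, by omega⟩ : Idx (n + 3)) * D.sigma (⟨1, by omega⟩ : Idx (n + 3)) *
        D.sigma (⟨0, by omega⟩ : Idx (n + 3)) =
      D.sigma (⟨1, by omega⟩ : Idx (n + 3)) * D.sigma (⟨0, by omega⟩ : Idx (n + 3)) *
        D.sigma (⟨1, by omega⟩ : Idx (n + 3)) := by
  let e : V ⊗[k] (V ⊗[k] (V ⊗[k] (⨂[k]^n V))) ≃ₗ[k] ⨂[k]^(n + 3) V :=
    (((tensorCons k V n).lTensor V).lTensor V).trans (tensorConsCons k V (n + 1))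
  have sigma_zero_e (x) : D.sigma (⟨0, by omega⟩ : Idx (n + 3)) (e x) =
      e (braidHead (D.braiding D) _ x) :=
    (D.sigma_zero _).trans (congrArg _ (LinearMap.congr_fun
      (braidHead_comp_lTensor_lTensor (D.braiding D) (tensorCons k V n).toLinearMap) x))
  have sigma_one_e (x) : D.sigma (⟨1, by omega⟩ : Idx (n + 3)) (e x) =
      e ((braidHead (D.braiding D) _).lTensor V x) := by
    have h : D.sigma (⟨0, by omega⟩ : Idx (n + 2)) ∘ₗ (tensorConsCons k V n).toLinearMap =
        (tensorConsCons k V n).toLinearMap ∘ₗ braidHead (D.braiding D) _ :=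
      LinearMap.ext D.sigma_zero
    have e_apply (x) :
        e x = tensorCons k V (n + 2) ((tensorConsCons k V n).toLinearMap.lTensor V x) := by
      rw [tensorConsCons, LinearEquiv.coe_trans, LinearMap.lTensor_comp_apply]
      rfl
    rw [e_apply, e_apply, show (⟨1, _⟩ : Idx (n + 3)) = Idx.shift ⟨0, by omega⟩ from rfl,
      sigma_shift, shiftEnd_tensorCons, ← LinearMap.lTensor_comp_apply, h,
      LinearMap.lTensor_comp_apply]
  refine LinearMap.ext fun y => ?_
  obtain ⟨x, rfl⟩ := e.surjective y
  simp only [Module.End.mul_apply, sigma_zero_e, sigma_one_e]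
  exact congrArg e (LinearMap.congr_fun (hD.braidHead_lTensor_braidHead _) x)

theorem braidRelations_sigma {D : YDData k H V} (hD : IsYangBaxter (D.braiding D)) (n : ℕ) :
    BraidRelations (fun i : Idx n => D.sigma i) := by
  induction n with
  | zero => exact ⟨fun i => absurd i.2 (by omega), fun i => absurd i.2 (by omega)⟩
  | succ n ih =>
    refine .of_comp_shift ?_ (fun hn j => ?_) fun hn => ?_
    · simp only [sigma_shift]
      exact ⟨fun i j hij => by rw [← map_mul, ih.comm i j hij, map_mul],
        fun i j hij => by simp only [← map_mul, ih.braid i j hij]⟩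
    · obtain ⟨n, rfl⟩ : ∃ m, n = m + 1 := ⟨n - 1, by omega⟩
      have sigma_add_two :
          D.sigma ⟨j.1 + 2, by omega⟩ = shiftEnd (n + 1) (shiftEnd n (D.sigma j)) :=
        (D.sigma_shift j.shift).trans (congrArg _ (D.sigma_shift j))
      rw [sigma_add_two]
      exact D.sigma_zero_mul_shiftEnd_shiftEnd (D.sigma j)
    · obtain ⟨n, rfl⟩ : ∃ m, n = m + 2 := ⟨n - 2, by omega⟩
      exact sigma_zero_mul_sigma_one_mul_sigma_zero hD n

/-- `1 + σ₀ + σ₀ σ₁ + ⋯ + σ₀ ⋯ σₙ₋₁` on `V^{⊗(n+1)}`. -/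
def cosetSum (D : YDData k H V) (n : ℕ) : Module.End k (⨂[k]^(n + 1) V) :=
  ∑ i : Fin (n + 1), initialProd D.sigma i

theorem cosetSum_zero (D : YDData k H V) : D.cosetSum 0 = 1 := by
  simp [cosetSum, initialProd_zero]

theorem cosetSum_succ (D : YDData k H V) (n : ℕ) :
    D.cosetSum (n + 1) =
      1 + D.sigma (⟨0, by omega⟩ : Idx (n + 2)) * shiftEnd (n + 1) (D.cosetSum n) := by
  have initialProd_shift (i : Fin (n + 1)) :
      initialProd (fun j : Idx (n + 1) => D.sigma j.shift) i =
        shiftEnd (n + 1) (initialProd D.sigma i) := by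
    simp only [initialProd, map_list_prod, List.map_map, sigma_shift, Function.comp_def]
  simp only [cosetSum, Fin.sum_univ_succ (n := n + 1), initialProd_zero, initialProd_succ_eq_mul,
    initialProd_shift, map_sum, Finset.mul_sum]

theorem symmetrizer_zero (D : YDData k H V) : D.symmetrizer 0 = 1 := by
  have eq_nil (l : List (Idx 0)) : l = [] :=
    List.eq_nil_iff_forall_not_mem.2 fun i => absurd i.2 (by omega)
  simp [symmetrizer, braidLift, eq_nil]

theorem symmetrizer_succ {D : YDData k H V} (hD : IsYangBaxter (D.braiding D)) (n : ℕ) :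
    D.symmetrizer (n + 1) = shiftEnd n (D.symmetrizer n) * D.cosetSum n := by
  refine (braidRelations_sigma hD (n + 1)).sum_prod_reducedWord.trans ?_
  simp only [cosetSum, symmetrizer, braidLift, map_sum, map_list_prod, List.map_map, sigma_shift,
    Function.comp_def]

end YDData

end Sigma

/-! ### Graded modules, algebras and coalgebras -/

section GradedModule

open DirectSum

variable {ι R M N : Type*} [DecidableEq ι] [CommSemiring R] [AddCommMonoid M] [Module R M]
  [AddCommMonoid N] [Module R N] (𝒜 : ι → Submodule R M) [Decomposition 𝒜]

/-- The projection of `M = ⨁ᵢ 𝒜 i` onto the component `𝒜 i`, as an endomorphism of `M`. -/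
def gradedProj (i : ι) : M →ₗ[R] M :=
  (𝒜 i).subtype ∘ₗ DirectSum.component R ι (fun i => 𝒜 i) i ∘ₗ
    (decomposeLinearEquiv 𝒜).toLinearMap

theorem gradedProj_mem (i : ι) (x : M) : gradedProj 𝒜 i x ∈ 𝒜 i :=
  Subtype.coe_prop _

variable {𝒜}

theorem gradedProj_of_mem {i : ι} {x : M} (hx : x ∈ 𝒜 i) : gradedProj 𝒜 i x = x :=
  decompose_of_mem_same 𝒜 hx

theorem gradedProj_of_mem_ne {i j : ι} {x : M} (hx : x ∈ 𝒜 i) (hij : i ≠ j) :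
    gradedProj 𝒜 j x = 0 :=
  decompose_of_mem_ne 𝒜 hx hij

theorem eq_zero_of_gradedProj_eq_zero {x : M} (hx : ∀ i, gradedProj 𝒜 i x = 0) : x = 0 :=
  (decomposeLinearEquiv 𝒜).map_eq_zero_iff.1 <|
    DirectSum.ext_component R fun i => Subtype.ext (hx i)

variable (𝒜) in
theorem linearMap_ext_of_decomposition {f g : M →ₗ[R] N} (h : ∀ i, ∀ x ∈ 𝒜 i, f x = g x) : f = g :=
  decompose_lhom_ext 𝒜 fun i => LinearMap.ext fun x => h i x x.2

theorem gradedProj_comp_of_mapsTo {ℬ : ι → Submodule R N} [Decomposition ℬ] {f : M →ₗ[R] N}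
    (hf : ∀ i, ∀ x ∈ 𝒜 i, f x ∈ ℬ i) (i : ι) : gradedProj ℬ i ∘ₗ f = f ∘ₗ gradedProj 𝒜 i := by
  refine linearMap_ext_of_decomposition 𝒜 fun j x hx => ?_
  rw [LinearMap.comp_apply, LinearMap.comp_apply]
  obtain rfl | hij := eq_or_ne j i
  · rw [gradedProj_of_mem hx, gradedProj_of_mem (hf j x hx)]
  · rw [gradedProj_of_mem_ne hx hij, gradedProj_of_mem_ne (hf j x hx) hij, map_zero]

end GradedModule

section Flat

variable {R M N : Type*} (Y : Type*) [CommRing R] [AddCommGroup M] [Module R M] [AddCommGroup N]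
  [Module R N] [AddCommGroup Y] [Module R Y] [Module.Flat R Y] {A : Submodule R M}
  {P : Module.End R M} {f : M →ₗ[R] N}

theorem injOn_rTensor_range_rTensor (hf : Set.InjOn f A) (hP : ∀ x, P x ∈ A) :
    Set.InjOn (f.rTensor Y) (LinearMap.range (P.rTensor Y)) := by
  have hinj := Module.Flat.rTensor_preserves_injective_linearMap (M := Y) (f ∘ₗ A.subtype)
    hf.injective
  rw [LinearMap.rTensor_comp, LinearMap.coe_comp] at hinj
  rw [← LinearMap.subtype_comp_codRestrict P A hP, LinearMap.rTensor_comp]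
  exact hinj.injOn_range.mono (LinearMap.range_comp_le_range _ _)

theorem injOn_lTensor_range_lTensor (hf : Set.InjOn f A) (hP : ∀ x, P x ∈ A) :
    Set.InjOn (f.lTensor Y) (LinearMap.range (P.lTensor Y)) := by
  have hinj := Module.Flat.lTensor_preserves_injective_linearMap (M := Y) (f ∘ₗ A.subtype)
    hf.injective
  rw [LinearMap.lTensor_comp, LinearMap.coe_comp] at hinj
  rw [← LinearMap.subtype_comp_codRestrict P A hP, LinearMap.lTensor_comp]
  exact hinj.injOn_range.mono (LinearMap.range_comp_le_range _ _)

end Flat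

section GradedAlgebra

open DirectSum

variable {ι k R : Type*} [CommSemiring k] [Semiring R] [Algebra k R]

theorem gradedProj_mul_of_mem [DecidableEq ι] [AddMonoid ι] [IsLeftCancelAdd ι]
    {𝒜 : ι → Submodule k R} [SetLike.GradedMul 𝒜] [Decomposition 𝒜] {i : ι} {x : R}
    (hx : x ∈ 𝒜 i) (y : R) : gradedProj 𝒜 i (x * y) = x * gradedProj 𝒜 0 y := by
  suffices gradedProj 𝒜 i ∘ₗ LinearMap.mulLeft k x =
      LinearMap.mulLeft k x ∘ₗ gradedProj 𝒜 0 from LinearMap.congr_fun this y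
  refine linearMap_ext_of_decomposition 𝒜 fun j y hy => ?_
  have hxy : x * y ∈ 𝒜 (i + j) := SetLike.mul_mem_graded hx hy
  simp only [LinearMap.comp_apply, LinearMap.mulLeft_apply]
  obtain rfl | hj := eq_or_ne j 0
  · rw [add_zero] at hxy
    rw [gradedProj_of_mem hxy, gradedProj_of_mem hy]
  · rw [gradedProj_of_mem_ne hxy (by simpa using hj), gradedProj_of_mem_ne hy hj, mul_zero]

/-- The component of `1` in degree `0` is a right unit, hence equal to `1`. -/
theorem one_mem_zero_of_decomposition [DecidableEq ι] [AddMonoid ι] [IsLeftCancelAdd ι]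
    (𝒜 : ι → Submodule k R) [SetLike.GradedMul 𝒜] [Decomposition 𝒜] : (1 : R) ∈ 𝒜 0 := by
  have h : LinearMap.mulRight k (gradedProj 𝒜 0 1) = LinearMap.id :=
    linearMap_ext_of_decomposition 𝒜 fun i x hx => by
      rw [LinearMap.mulRight_apply, ← gradedProj_mul_of_mem hx, mul_one, gradedProj_of_mem hx,
        LinearMap.id_apply]
  have h1 := LinearMap.congr_fun h 1
  rw [LinearMap.mulRight_apply, one_mul, LinearMap.id_apply] at h1
  exact h1 ▸ gradedProj_mem 𝒜 0 1

theorem submodule_pow_le_of_gradedMonoid [AddMonoid ι] (𝒜 : ι → Submodule k R)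
    [SetLike.GradedMonoid 𝒜] (i : ι) (n : ℕ) : 𝒜 i ^ n ≤ 𝒜 (n • i) := by
  induction n with
  | zero => simpa only [pow_zero, zero_smul, Submodule.one_le] using SetLike.GradedOne.one_mem
  | succ n ih =>
    rw [pow_succ, succ_nsmul, Submodule.mul_le]
    exact fun x hx y hy => SetLike.mul_mem_graded (ih hx) hy

theorem eq_pow_of_iSup_le_mul {𝒜 : ℕ → Submodule k R} [SetLike.GradedMonoid 𝒜] [Decomposition 𝒜]
    (zero_le_one : 𝒜 0 ≤ 1) (iSup_le_mul : ⨆ i ≥ 2, 𝒜 i ≤ (⨆ i ≥ 1, 𝒜 i) * ⨆ i ≥ 1, 𝒜 i) (n : ℕ) :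
    𝒜 n = 𝒜 1 ^ n := by
  have pow_le (n : ℕ) : 𝒜 1 ^ n ≤ 𝒜 n := by
    simpa only [smul_eq_mul, mul_one] using submodule_pow_le_of_gradedMonoid 𝒜 1 n
  refine le_antisymm ?_ (pow_le n)
  induction n using Nat.strong_induction_on with
  | _ n ih =>
    match n with
    | 0 => rwa [pow_zero]
    | 1 => rw [pow_one]
    | n + 2 =>
      have mul_le_comap : (⨆ i ≥ 1, 𝒜 i) * ⨆ i ≥ 1, 𝒜 i ≤
          (𝒜 1 ^ (n + 2)).comap (gradedProj 𝒜 (n + 2)) := by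
        simp only [Submodule.iSup_mul, Submodule.mul_iSup, iSup_le_iff, Submodule.mul_le]
        intro j hj i hi x hx y hy
        rw [Submodule.mem_comap]
        by_cases hij : i + j = n + 2
        · have hxy := Submodule.mul_mem_mul (ih i (by omega) hx) (ih j (by omega) hy)
          rw [← pow_add, hij] at hxy
          rwa [gradedProj_of_mem (pow_le _ hxy)]
        · rw [gradedProj_of_mem_ne (SetLike.mul_mem_graded hx hy) hij]
          exact zero_mem _
      intro x hx
      have h := mul_le_comap (iSup_le_mul
        (Submodule.mem_iSup_of_mem (n + 2) (Submodule.mem_iSup_of_mem (by omega) hx)))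
      rwa [Submodule.mem_comap, gradedProj_of_mem hx] at h

end GradedAlgebra

section GradedCoalgebra

open DirectSum Coalgebra

/-- The comultiplication of the coalgebra `C` respects the family of submodules `𝒜`:
`Δ(𝒜 n)` is contained in the sum of the images of the `𝒜 i ⊗ 𝒜 j` with `i + j = n`. -/
structure IsGradedComul {k C : Type*} [CommSemiring k] [AddCommMonoid C] [Module k C]
    [Coalgebra k C] (𝒜 : ℕ → Submodule k C) : Prop where
  comul_mem : ∀ n, ∀ x ∈ 𝒜 n, comul (R := k) x ∈
    ⨆ (i : ℕ) (j : ℕ) (_ : i + j = n),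
      LinearMap.range (TensorProduct.map (𝒜 i).subtype (𝒜 j).subtype)

namespace IsGradedComul

variable {k C : Type*} [CommSemiring k] [AddCommMonoid C] [Module k C] [Coalgebra k C]
  {𝒜 : ℕ → Submodule k C}

theorem comul_ext (hC : IsGradedComul 𝒜) {X : Type*} [AddCommMonoid X] [Module k X]
    {f g : C ⊗[k] C →ₗ[k] X} {n : ℕ}
    (h : ∀ i j, i + j = n → ∀ a ∈ 𝒜 i, ∀ b ∈ 𝒜 j, f (a ⊗ₜ b) = g (a ⊗ₜ b)) {x : C}
    (hx : x ∈ 𝒜 n) : f (comul x) = g (comul x) := by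
  have le_eqLocus : (⨆ (i : ℕ) (j : ℕ) (_ : i + j = n),
      LinearMap.range (TensorProduct.map (𝒜 i).subtype (𝒜 j).subtype)) ≤
      LinearMap.eqLocus f g := by
    refine iSup_le fun i => iSup_le fun j => iSup_le fun hij => LinearMap.range_le_iff_comap.2 ?_
    rw [← top_le_iff, ← TensorProduct.span_tmul_eq_top k (𝒜 i) (𝒜 j), Submodule.span_le]
    rintro _ ⟨a, b, rfl⟩
    exact h i j hij a a.2 b b.2
  exact le_eqLocus (hC.comul_mem n x hx)

variable [Decomposition 𝒜]

theorem map_gradedProj_comul (hC : IsGradedComul 𝒜) (i j : ℕ) (x : C) :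
    TensorProduct.map (gradedProj 𝒜 i) (gradedProj 𝒜 j) (comul x) =
      (gradedProj 𝒜 i).rTensor C (comul (gradedProj 𝒜 (i + j) x)) := by
  suffices TensorProduct.map (gradedProj 𝒜 i) (gradedProj 𝒜 j) ∘ₗ comul =
      (gradedProj 𝒜 i).rTensor C ∘ₗ comul ∘ₗ gradedProj 𝒜 (i + j) from LinearMap.congr_fun this x
  refine linearMap_ext_of_decomposition 𝒜 fun n x hx => ?_
  rw [LinearMap.comp_apply, LinearMap.comp_apply, LinearMap.comp_apply]
  obtain rfl | hn := eq_or_ne n (i + j)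
  · rw [gradedProj_of_mem hx]
    refine hC.comul_ext (fun p q hpq a ha b hb => ?_) hx
    rw [TensorProduct.map_tmul, LinearMap.rTensor_tmul]
    obtain rfl | hp := eq_or_ne p i
    · rw [gradedProj_of_mem (i := j) (by rwa [show j = q by omega])]
    · rw [gradedProj_of_mem_ne ha hp, TensorProduct.zero_tmul, TensorProduct.zero_tmul]
  · rw [gradedProj_of_mem_ne hx hn, map_zero, map_zero]
    refine hC.comul_ext (g := 0) (fun p q hpq a ha b hb => ?_) hx
    rw [TensorProduct.map_tmul, LinearMap.zero_apply]
    obtain rfl | hp := eq_or_ne p i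
    · rw [gradedProj_of_mem_ne hb (by omega), TensorProduct.tmul_zero]
    · rw [gradedProj_of_mem_ne ha hp, TensorProduct.zero_tmul]

/-- `ε ∘ gradedProj 𝒜 0` is a left counit, hence equal to `ε`. -/
theorem counit_gradedProj_zero (hC : IsGradedComul 𝒜) (x : C) :
    counit (R := k) (gradedProj 𝒜 0 x) = counit x := by
  let ε₀ : C →ₗ[k] k := counit ∘ₗ gradedProj 𝒜 0
  have lid_rTensor_comul :
      (TensorProduct.lid k C).toLinearMap ∘ₗ ε₀.rTensor C ∘ₗ comul = LinearMap.id := by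
    refine linearMap_ext_of_decomposition 𝒜 fun n x hx => ?_
    trans (TensorProduct.lid k C).toLinearMap
      ((counit (R := k) (A := C)).rTensor C ((gradedProj 𝒜 n).lTensor C (comul x)))
    · refine hC.comul_ext (f := (TensorProduct.lid k C).toLinearMap ∘ₗ ε₀.rTensor C)
        (g := (TensorProduct.lid k C).toLinearMap ∘ₗ (counit (R := k) (A := C)).rTensor C ∘ₗ
          (gradedProj 𝒜 n).lTensor C) (fun i j hij a ha b hb => ?_) hx
      simp only [LinearMap.comp_apply, LinearMap.rTensor_tmul, LinearMap.lTensor_tmul, ε₀]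
      obtain rfl | hi := eq_or_ne i 0
      · rw [gradedProj_of_mem ha, gradedProj_of_mem (by rwa [show n = j by omega])]
      · rw [gradedProj_of_mem_ne ha hi, gradedProj_of_mem_ne hb (by omega), map_zero,
          TensorProduct.zero_tmul, TensorProduct.tmul_zero]
    · rw [← LinearMap.comp_apply (LinearMap.rTensor _ _), LinearMap.rTensor_comp_lTensor,
        ← LinearMap.lTensor_comp_rTensor, LinearMap.comp_apply, rTensor_counit_comul,
        LinearMap.lTensor_tmul, gradedProj_of_mem hx]
      exact one_smul k x
  have counit_lid (t : C ⊗[k] C) : counit (R := k) (TensorProduct.lid k C (ε₀.rTensor C t)) =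
      ε₀ (TensorProduct.rid k C ((counit (R := k) (A := C)).lTensor C t)) := by
    induction t with
    | zero => simp only [map_zero]
    | add s t hs ht => simp only [map_add, hs, ht]
    | tmul a b => simp [mul_comm]
  have h := counit_lid (comul x)
  rw [lTensor_counit_comul, TensorProduct.rid_tmul, one_smul] at h
  exact h.symm.trans (congrArg counit (LinearMap.congr_fun lid_rTensor_comul x))

theorem comul_eq_sum (hC : IsGradedComul 𝒜) {n : ℕ} {x : C} (hx : x ∈ 𝒜 n) :
    comul x = ∑ i ∈ Finset.range (n + 1), (gradedProj 𝒜 i).rTensor C (comul x) := by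
  rw [← LinearMap.sum_apply]
  refine hC.comul_ext (f := LinearMap.id) (fun i j hij a ha b _ => ?_) hx
  rw [LinearMap.sum_apply, Finset.sum_eq_single_of_mem i (Finset.mem_range.2 (by omega)),
    LinearMap.rTensor_tmul, gradedProj_of_mem ha, LinearMap.id_apply]
  intro l _ hl
  rw [LinearMap.rTensor_tmul, gradedProj_of_mem_ne ha hl.symm, TensorProduct.zero_tmul]

theorem rTensor_gradedProj_comul_of_mem (hC : IsGradedComul 𝒜) {n : ℕ} {x : C} (hx : x ∈ 𝒜 n) :
    (gradedProj 𝒜 n).rTensor C (comul x) = (gradedProj 𝒜 0).lTensor C (comul x) := by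
  refine hC.comul_ext (fun i j hij a ha b hb => ?_) hx
  rw [LinearMap.rTensor_tmul, LinearMap.lTensor_tmul]
  obtain rfl | hj := eq_or_ne j 0
  · rw [gradedProj_of_mem (by rwa [show n = i by omega]), gradedProj_of_mem hb]
  · rw [gradedProj_of_mem_ne ha (by omega), gradedProj_of_mem_ne hb hj, TensorProduct.zero_tmul,
      TensorProduct.tmul_zero]

end IsGradedComul

namespace IsGradedComul

variable {k R : Type*} [CommSemiring k] [Semiring R] [Algebra k R] [Coalgebra k R]
  {𝒜 : ℕ → Submodule k R} [Decomposition 𝒜]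

theorem gradedProj_zero (hR : IsGradedComul 𝒜) (zero_le_one : 𝒜 0 ≤ 1)
    (counit_one : counit (R := k) (1 : R) = 1) :
    gradedProj 𝒜 0 = LinearMap.toSpanSingleton k R 1 ∘ₗ counit := by
  refine LinearMap.ext fun x => ?_
  obtain ⟨c, hc⟩ := Submodule.mem_one.1 (zero_le_one (gradedProj_mem 𝒜 0 x))
  rw [Algebra.algebraMap_eq_smul_one] at hc
  rw [LinearMap.comp_apply, LinearMap.toSpanSingleton_apply, ← hR.counit_gradedProj_zero, ← hc,
    map_smul, counit_one, smul_eq_mul, mul_one]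

theorem comul_eq_of_mem (hR : IsGradedComul 𝒜) (zero_le_one : 𝒜 0 ≤ 1)
    (counit_one : counit (R := k) (1 : R) = 1) {n : ℕ} {x : R} (hx : x ∈ 𝒜 (n + 1)) :
    comul x = 1 ⊗ₜ x + x ⊗ₜ 1 +
      ∑ i ∈ Finset.range n, (gradedProj 𝒜 (i + 1)).rTensor R (comul x) := by
  conv_lhs => rw [hR.comul_eq_sum hx]
  rw [Finset.sum_range_succ, Finset.sum_range_succ', hR.rTensor_gradedProj_comul_of_mem hx,
    hR.gradedProj_zero zero_le_one counit_one, LinearMap.rTensor_comp_apply, rTensor_counit_comul,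
    LinearMap.lTensor_comp_apply, lTensor_counit_comul, LinearMap.rTensor_tmul,
    LinearMap.lTensor_tmul, LinearMap.toSpanSingleton_apply, one_smul, add_assoc, add_comm]

end IsGradedComul

end GradedCoalgebra

section Primitives

open Coalgebra

variable {k R : Type*} [Field k] [Ring R] [Algebra k R] [Coalgebra k R]

theorem mem_primitives {x : R} : x ∈ primitives k R ↔ comul (R := k) x = 1 ⊗ₜ x + x ⊗ₜ 1 :=
  Iff.rfl

theorem counit_of_mem_primitives (counit_one : counit (R := k) (1 : R) = 1) {x : R}
    (hx : x ∈ primitives k R) : counit (R := k) x = 0 := by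
  have h := lTensor_counit_comul (R := k) x
  rw [mem_primitives.1 hx, map_add, LinearMap.lTensor_tmul, LinearMap.lTensor_tmul, counit_one,
    add_eq_right] at h
  have h' := congrArg (LinearMap.mul' k k) (congrArg (TensorProduct.map counit LinearMap.id) h)
  simpa [counit_one] using h'

theorem le_primitives {𝒜 : ℕ → Submodule k R} [DirectSum.Decomposition 𝒜]
    (hR : IsGradedComul 𝒜) (zero_le_one : 𝒜 0 ≤ 1)
    (counit_one : counit (R := k) (1 : R) = 1) : 𝒜 1 ≤ primitives k R := fun x hx =>
  mem_primitives.2 <| by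
    rw [hR.comul_eq_of_mem zero_le_one counit_one hx, Finset.sum_range_zero, add_zero]

theorem eq_zero_of_rTensor_comul_eq_zero {𝒜 : ℕ → Submodule k R} [DirectSum.Decomposition 𝒜]
    (hR : IsGradedComul 𝒜) (zero_le_one : 𝒜 0 ≤ 1) (counit_one : counit (R := k) (1 : R) = 1)
    (primitives_le : primitives k R ≤ 𝒜 1) {n : ℕ} (hn : n ≠ 0) {x : R} (hx : x ∈ 𝒜 (n + 1))
    (h : ∀ i < n, (gradedProj 𝒜 (i + 1)).rTensor R (comul x) = 0) : x = 0 := by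
  have x_primitive : x ∈ primitives k R := by
    rw [mem_primitives, hR.comul_eq_of_mem zero_le_one counit_one hx,
      Finset.sum_eq_zero fun i hi => h i (Finset.mem_range.1 hi), add_zero]
  rw [← gradedProj_of_mem hx, gradedProj_of_mem_ne (primitives_le x_primitive) (by omega)]

end Primitives

/-! ### Graded braided Hopf algebras -/

section BraidedHopf

variable {k H R : Type*} [Field k] [Ring H] [HopfAlgebra k H] [Ring R] [Algebra k R]

theorem YDData.braidedMul_tmul (D : YDData k H R) (a b a' b' : R) :
    D.braidedMul ((a ⊗ₜ b) ⊗ₜ (a' ⊗ₜ b')) =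
      TensorProduct.map (LinearMap.mulLeft k a) (LinearMap.mulRight k b')
        (D.braiding D (b ⊗ₜ a')) := by
  simp only [braidedMul, LinearMap.comp_apply, LinearEquiv.coe_coe, TensorProduct.assoc_tmul,
    LinearMap.lTensor_tmul, TensorProduct.assoc_symm_tmul, LinearMap.rTensor_tmul]
  generalize D.braiding D (b ⊗ₜ a') = t
  induction t with
  | zero => simp
  | add x y hx hy => simp only [map_add, TensorProduct.add_tmul, TensorProduct.tmul_add, hx, hy]
  | tmul x y => simp

variable [Coalgebra k R] {D : YDData k H R} {𝒜 : ℕ → Submodule k R}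

theorem IsBraidedHopfAlgebra.braiding_one_tmul (hR : IsBraidedHopfAlgebra D) (a : R) :
    D.braiding D (1 ⊗ₜ a) = a ⊗ₜ 1 := by
  have coact_one := hR.unit_hom.map_coact 1
  rw [Algebra.linearMap_apply, map_one] at coact_one
  rw [YDData.braiding_tmul, coact_one]
  simp [YDData.unit, hR.yetterDrinfeld.act_one]

namespace IsGradedBraidedHopfAlgebra

theorem isGradedComul (hR : IsGradedBraidedHopfAlgebra D 𝒜) : IsGradedComul 𝒜 :=
  ⟨hR.comul_mem⟩

variable [DirectSum.Decomposition 𝒜]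

theorem gradedMonoid (hR : IsGradedBraidedHopfAlgebra D 𝒜) : SetLike.GradedMonoid 𝒜 :=
  haveI : SetLike.GradedMul 𝒜 := ⟨fun _ _ _ _ hx hy => hR.mul_mem _ _ _ hx _ hy⟩
  { one_mem := one_mem_zero_of_decomposition 𝒜 }

theorem gradedProj_act (hR : IsGradedBraidedHopfAlgebra D 𝒜) (n : ℕ) (h : H) (x : R) :
    gradedProj 𝒜 n (D.act h x) = D.act h (gradedProj 𝒜 n x) :=
  LinearMap.congr_fun (gradedProj_comp_of_mapsTo (fun i => (hR.isSub i).act_mem h) n) x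

end IsGradedBraidedHopfAlgebra

theorem IsTOBA.zero_le_one [DirectSum.Decomposition 𝒜] (hR : IsTOBA D 𝒜) : 𝒜 0 ≤ 1 := by
  have := hR.gradedMonoid
  obtain ⟨e⟩ := hR.zero_equiv
  have one_ne_zero : (⟨1, SetLike.GradedOne.one_mem⟩ : 𝒜 0) ≠ 0 := fun h => by
    have h0 := hR.counit_one
    rw [show (1 : R) = 0 from congrArg Subtype.val h, map_zero] at h0
    exact zero_ne_one h0
  intro x hx
  obtain ⟨c, hc⟩ := (finrank_eq_one_iff_of_nonzero' _ one_ne_zero).1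
    (e.finrank_eq.trans (Module.finrank_self k)) ⟨x, hx⟩
  exact Submodule.mem_one.2
    ⟨c, (Algebra.algebraMap_eq_smul_one c).trans (congrArg Subtype.val hc)⟩

end BraidedHopf

/-! ### Skew derivations and the kernel of `A(V) → R` -/

section DegreeOne

variable {k H R V : Type*} [Field k] [Ring H] [HopfAlgebra k H] [Ring R] [Algebra k R]
  [AddCommGroup V] [Module k V]

/-- The linear map `j` identifies the Yetter–Drinfeld module `V` with the component `R(1)`. -/
structure IsDegreeOne (D : YDData k H R) (𝒜 : ℕ → Submodule k R) (DV : YDData k H V)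
    (j : V →ₗ[k] R) : Prop where
  injective : Function.Injective j
  range_eq : LinearMap.range j = 𝒜 1
  isHom : DV.IsHom D j

/-- The projection `R → R(1) ≃ V`, for an injective map `j : V → R` with image `R(1)`. -/
noncomputable def degreeOneProj (𝒜 : ℕ → Submodule k R) [DirectSum.Decomposition 𝒜]
    (j : V →ₗ[k] R) : R →ₗ[k] V :=
  j.leftInverse ∘ₗ gradedProj 𝒜 1

namespace IsDegreeOne

variable {D : YDData k H R} {𝒜 : ℕ → Submodule k R} {DV : YDData k H V} {j : V →ₗ[k] R}

theorem mem (hj : IsDegreeOne D 𝒜 DV j) (v : V) : j v ∈ 𝒜 1 :=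
  hj.range_eq ▸ LinearMap.mem_range_self j v

theorem isYangBaxter (hj : IsDegreeOne D 𝒜 DV j) (hD : D.IsYetterDrinfeld) :
    IsYangBaxter (DV.braiding DV) :=
  hD.isYangBaxter.of_injective hj.injective hj.isHom.map_comp_braiding

variable [DirectSum.Decomposition 𝒜]

theorem apply_proj (hj : IsDegreeOne D 𝒜 DV j) (x : R) :
    j (degreeOneProj 𝒜 j x) = gradedProj 𝒜 1 x := by
  obtain ⟨v, hv⟩ : gradedProj 𝒜 1 x ∈ LinearMap.range j := hj.range_eq ▸ gradedProj_mem 𝒜 1 x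
  rw [degreeOneProj, LinearMap.comp_apply, ← hv,
    LinearMap.leftInverse_apply_of_inj (LinearMap.ker_eq_bot.2 hj.injective)]

theorem proj_act [Coalgebra k R] (hR : IsGradedBraidedHopfAlgebra D 𝒜)
    (hj : IsDegreeOne D 𝒜 DV j) (h : H) (x : R) :
    degreeOneProj 𝒜 j (D.act h x) = DV.act h (degreeOneProj 𝒜 j x) :=
  hj.injective (by rw [hj.apply_proj, hR.gradedProj_act, hj.isHom.map_act, hj.apply_proj])

theorem proj_mul [Coalgebra k R] (hR : IsGradedBraidedHopfAlgebra D 𝒜) (zero_le_one : 𝒜 0 ≤ 1)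
    (hj : IsDegreeOne D 𝒜 DV j) (v : V) (x : R) :
    degreeOneProj 𝒜 j (j v * x) = Coalgebra.counit (R := k) x • v := by
  have := hR.gradedMonoid
  refine hj.injective ?_
  rw [hj.apply_proj, gradedProj_mul_of_mem (hj.mem v),
    hR.isGradedComul.gradedProj_zero zero_le_one hR.counit_one, LinearMap.comp_apply,
    LinearMap.toSpanSingleton_apply, mul_smul_comm, mul_one, map_smul]

end IsDegreeOne

end DegreeOne

section TensorPowerLift

variable {k R V : Type*} [CommRing k] [Ring R] [Algebra k R] [AddCommGroup V] [Module k V]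

/-- The map `V ⊗ R → R`, `v ⊗ x ↦ j(v) x`. -/
def leftMul (j : V →ₗ[k] R) : V ⊗[k] R →ₗ[k] R :=
  LinearMap.mul' k R ∘ₗ j.rTensor R

theorem leftMul_tmul (j : V →ₗ[k] R) (v : V) (x : R) : leftMul j (v ⊗ₜ x) = j v * x :=
  rfl

/-- The map `V^{⊗n} → R`, `v₁ ⊗ ⋯ ⊗ vₙ ↦ j(v₁) ⋯ j(vₙ)`. -/
def tensorPowerLift (j : V →ₗ[k] R) (n : ℕ) : ⨂[k]^n V →ₗ[k] R :=
  (TensorAlgebra.lift k j).toLinearMap ∘ₗ TensorPower.toTensorAlgebra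

theorem tensorPowerLift_zero (j : V →ₗ[k] R) (t : ⨂[k]^0 V) :
    tensorPowerLift j 0 t = PiTensorProduct.isEmptyEquiv (Fin 0) t • 1 := by
  suffices tensorPowerLift j 0 =
      (PiTensorProduct.isEmptyEquiv (R := k) (s := fun _ => V) (Fin 0)).toLinearMap.smulRight 1 from
    LinearMap.congr_fun this t
  ext v
  simp [tensorPowerLift, TensorAlgebra.tprod_apply]

theorem tensorPowerLift_comp_tensorCons (j : V →ₗ[k] R) (n : ℕ) :
    tensorPowerLift j (n + 1) ∘ₗ (tensorCons k V n).toLinearMap =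
      leftMul j ∘ₗ (tensorPowerLift j n).lTensor V := by
  ext v w
  simp [tensorPowerLift, tensorCons_tprod, TensorAlgebra.tprod_apply, leftMul_tmul]

theorem tensorPowerLift_tensorCons (j : V →ₗ[k] R) (n : ℕ) (x : V ⊗[k] (⨂[k]^n V)) :
    tensorPowerLift j (n + 1) (tensorCons k V n x) =
      leftMul j ((tensorPowerLift j n).lTensor V x) :=
  LinearMap.congr_fun (tensorPowerLift_comp_tensorCons j n) x

theorem tensorPowerLift_mem {𝒜 : ℕ → Submodule k R} [SetLike.GradedMonoid 𝒜] {j : V →ₗ[k] R}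
    (hj : ∀ v, j v ∈ 𝒜 1) (n : ℕ) (t : ⨂[k]^n V) : tensorPowerLift j n t ∈ 𝒜 n := by
  induction n with
  | zero => exact tensorPowerLift_zero j t ▸ Submodule.smul_mem _ _ SetLike.GradedOne.one_mem
  | succ n ih =>
    obtain ⟨x, rfl⟩ := (tensorCons k V n).surjective t
    rw [tensorPowerLift_tensorCons]
    induction x with
    | zero => simp only [map_zero, zero_mem]
    | add x y hx hy => simpa only [map_add] using add_mem hx hy
    | tmul v t =>
      rw [LinearMap.lTensor_tmul, leftMul_tmul, add_comm]
      exact SetLike.mul_mem_graded (hj v) (ih t)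

theorem gradedProj_lift {𝒜 : ℕ → Submodule k R} [SetLike.GradedMonoid 𝒜]
    [DirectSum.Decomposition 𝒜] {j : V →ₗ[k] R} (hj : ∀ v, j v ∈ 𝒜 1) (n : ℕ)
    (x : TensorAlgebra k V) :
    gradedProj 𝒜 n (TensorAlgebra.lift k j x) =
      tensorPowerLift j n (TensorAlgebra.equivDirectSum x n) := by
  suffices gradedProj 𝒜 n ∘ₗ (TensorAlgebra.lift k j).toLinearMap ∘ₗ
      (TensorAlgebra.equivDirectSum (R := k) (M := V)).symm.toLinearMap =
      tensorPowerLift j n ∘ₗ DirectSum.component k ℕ (fun n => ⨂[k]^n V) n by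
    obtain ⟨d, rfl⟩ := (TensorAlgebra.equivDirectSum (R := k) (M := V)).symm.surjective x
    rw [AlgEquiv.apply_symm_apply]
    exact LinearMap.congr_fun this d
  refine DirectSum.linearMap_ext k fun m => LinearMap.ext fun t => ?_
  have lift_of : TensorAlgebra.lift k j ((TensorAlgebra.equivDirectSum (R := k) (M := V)).symm
      (DirectSum.lof k ℕ (fun n => ⨂[k]^n V) m t)) = tensorPowerLift j m t :=
    congrArg _ (DirectSum.toAddMonoid_of (fun _ ↦
      LinearMap.toAddMonoidHom (TensorPower.toTensorAlgebra (R := k) (M := V))) m t)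
  simp only [LinearMap.comp_apply, AlgEquiv.toLinearMap_apply, AlgHom.toLinearMap_apply, lift_of]
  obtain rfl | hm := eq_or_ne m n
  · rw [DirectSum.component.lof_self, gradedProj_of_mem (tensorPowerLift_mem hj m t)]
  · rw [DirectSum.component.of, dif_neg hm, map_zero,
      gradedProj_of_mem_ne (tensorPowerLift_mem hj m t) hm]

end TensorPowerLift

section SkewDerivation

variable {k H R V : Type*} [Field k] [Ring H] [HopfAlgebra k H] [Ring R] [Algebra k R]
  [Coalgebra k R] [AddCommGroup V] [Module k V] {D : YDData k H R} (𝒜 : ℕ → Submodule k R)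
  [DirectSum.Decomposition 𝒜] {DV : YDData k H V} (j : V →ₗ[k] R)

/-- The component `∂ : R → V ⊗ R` of the comultiplication, where `j` identifies `V` with `R(1)`. -/
noncomputable def skewDer : R →ₗ[k] V ⊗[k] R :=
  (degreeOneProj 𝒜 j).rTensor R ∘ₗ Coalgebra.comul

/-- The component `R → V^{⊗n}` of the iterated comultiplication, where `j` identifies `V` with
`R(1)`. -/
noncomputable def iterSkewDer : (n : ℕ) → R →ₗ[k] ⨂[k]^n V
  | 0 => (PiTensorProduct.isEmptyEquiv (Fin 0)).symm.toLinearMap ∘ₗ Coalgebra.counit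
  | n + 1 => (tensorCons k V n).toLinearMap ∘ₗ (iterSkewDer n).lTensor V ∘ₗ skewDer 𝒜 j

theorem skewDer_comp_gradedProj (hR : IsGradedComul 𝒜) (n : ℕ) :
    skewDer 𝒜 j ∘ₗ gradedProj 𝒜 (n + 1) = (gradedProj 𝒜 n).lTensor V ∘ₗ skewDer 𝒜 j := by
  have rTensor_proj : (degreeOneProj 𝒜 j).rTensor R =
      j.leftInverse.rTensor R ∘ₗ (gradedProj 𝒜 1).rTensor R := LinearMap.rTensor_comp _ _ _
  refine LinearMap.ext fun x => ?_
  simp only [skewDer, LinearMap.comp_apply]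
  rw [rTensor_proj, LinearMap.comp_apply, add_comm n 1, ← hR.map_gradedProj_comul,
    ← rTensor_proj, ← LinearMap.comp_apply (LinearMap.lTensor _ _),
    LinearMap.lTensor_comp_rTensor, ← LinearMap.comp_apply (LinearMap.rTensor _ _),
    LinearMap.rTensor_comp_map]
  rfl

theorem skewDer_coassoc :
    (skewDer 𝒜 j).rTensor R ∘ₗ Coalgebra.comul = (TensorProduct.assoc k V R R).symm.toLinearMap ∘ₗ
      (Coalgebra.comul (R := k) (A := R)).lTensor V ∘ₗ skewDer 𝒜 j := by
  rw [skewDer, LinearMap.rTensor_comp, LinearMap.comp_assoc, ← Coalgebra.coassoc_symm,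
    ← LinearMap.comp_assoc Coalgebra.comul ((degreeOneProj 𝒜 j).rTensor R),
    LinearMap.lTensor_comp_rTensor,
    ← LinearMap.rTensor_comp_lTensor, LinearMap.rTensor_tensor]
  refine LinearMap.ext fun x => ?_
  simp only [LinearMap.comp_apply, LinearEquiv.coe_coe, LinearEquiv.symm_apply_apply]

theorem lTensor_counit_skewDer (x : R) :
    (Coalgebra.counit (R := k) (A := R)).lTensor V (skewDer 𝒜 j x) =
      degreeOneProj 𝒜 j x ⊗ₜ 1 := by
  rw [skewDer, LinearMap.comp_apply, ← LinearMap.comp_apply (LinearMap.lTensor _ _),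
    LinearMap.lTensor_comp_rTensor, ← LinearMap.rTensor_comp_lTensor, LinearMap.comp_apply,
    Coalgebra.lTensor_counit_comul, LinearMap.rTensor_tmul]

variable {𝒜 j}

theorem skewDer_one [SetLike.GradedOne 𝒜] (comul_one : Coalgebra.comul (R := k) (1 : R) = 1 ⊗ₜ 1) :
    skewDer 𝒜 j 1 = 0 := by
  rw [skewDer, LinearMap.comp_apply, comul_one, LinearMap.rTensor_tmul, degreeOneProj,
    LinearMap.comp_apply, gradedProj_of_mem_ne SetLike.GradedOne.one_mem zero_ne_one, map_zero,
    TensorProduct.zero_tmul]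

theorem skewDer_injOn (hR : IsGradedBraidedHopfAlgebra D 𝒜) (zero_le_one : 𝒜 0 ≤ 1)
    (primitives_le : primitives k R ≤ 𝒜 1) (hj : IsDegreeOne D 𝒜 DV j) (n : ℕ) :
    Set.InjOn (skewDer 𝒜 j) (𝒜 (n + 1)) := by
  induction n using Nat.strong_induction_on with
  | _ n ih =>
    refine (Set.injOn_iff_map_eq_zero _ _).2 fun x hx h0 => ?_
    obtain rfl | hn := eq_or_ne n 0
    · have proj_eq_zero : degreeOneProj 𝒜 j x = 0 := by
        have h := lTensor_counit_skewDer 𝒜 j x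
        rwa [h0, map_zero, ← (TensorProduct.rid k V).injective.eq_iff, map_zero,
          TensorProduct.rid_tmul, one_smul, eq_comm] at h
      rw [← gradedProj_of_mem hx, zero_add, ← hj.apply_proj, proj_eq_zero, map_zero]
    · refine eq_zero_of_rTensor_comul_eq_zero hR.isGradedComul zero_le_one hR.counit_one
        primitives_le hn hx fun i hi => ?_
      refine injOn_rTensor_range_rTensor R (ih i hi) (gradedProj_mem 𝒜 _) ⟨_, rfl⟩ (zero_mem _) ?_
      rw [← LinearMap.rTensor_comp_apply, skewDer_comp_gradedProj 𝒜 j hR.isGradedComul,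
        LinearMap.rTensor_comp_apply, ← LinearMap.comp_apply ((skewDer 𝒜 j).rTensor R),
        skewDer_coassoc, LinearMap.comp_apply, LinearMap.comp_apply, h0]
      simp only [map_zero]

theorem iterSkewDer_injOn (hR : IsGradedBraidedHopfAlgebra D 𝒜) (zero_le_one : 𝒜 0 ≤ 1)
    (primitives_le : primitives k R ≤ 𝒜 1) (hj : IsDegreeOne D 𝒜 DV j) (n : ℕ) :
    Set.InjOn (iterSkewDer 𝒜 j n) (𝒜 n) := by
  induction n with
  | zero =>
    refine (Set.injOn_iff_map_eq_zero _ _).2 fun x hx h0 => ?_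
    have counit_eq_zero : Coalgebra.counit (R := k) x = 0 :=
      (PiTensorProduct.isEmptyEquiv (Fin 0)).symm.map_eq_zero_iff.1 h0
    rw [← gradedProj_of_mem hx, hR.isGradedComul.gradedProj_zero zero_le_one hR.counit_one,
      LinearMap.comp_apply, counit_eq_zero, map_zero]
  | succ n ih =>
    refine (Set.injOn_iff_map_eq_zero _ _).2 fun x hx h0 => ?_
    have h : (iterSkewDer 𝒜 j n).lTensor V (skewDer 𝒜 j x) = 0 :=
      (tensorCons k V n).map_eq_zero_iff.1 h0
    have skewDer_mem : skewDer 𝒜 j x ∈ LinearMap.range ((gradedProj 𝒜 n).lTensor V) :=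
      ⟨skewDer 𝒜 j x, by
        rw [← LinearMap.comp_apply, ← skewDer_comp_gradedProj 𝒜 j hR.isGradedComul,
          LinearMap.comp_apply, gradedProj_of_mem hx]⟩
    refine skewDer_injOn hR zero_le_one primitives_le hj n hx (zero_mem _) ?_
    rw [map_zero]
    exact injOn_lTensor_range_lTensor V ih (gradedProj_mem 𝒜 n) skewDer_mem (zero_mem _)
      (h.trans (map_zero _).symm)

/-- The Leibniz rule `∂(v x) = v ⊗ x + (id ⊗ μ)(c ⊗ id)(v ⊗ ∂x)`: only the terms `v ⊗ x` and
`(1 ⊗ v) Δ(x)` of `Δ(v) Δ(x)` have a left factor with a component in degree one. -/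
theorem skewDer_leftMul (hR : IsGradedBraidedHopfAlgebra D 𝒜) (zero_le_one : 𝒜 0 ≤ 1)
    (hj : IsDegreeOne D 𝒜 DV j) (x : V ⊗[k] R) :
    skewDer 𝒜 j (leftMul j x) = x + (leftMul j).lTensor V
      (braidHead (DV.braiding DV) R ((skewDer 𝒜 j).lTensor V x)) := by
  have proj_mul_left (v : V) (t : R ⊗[k] R) :
      (degreeOneProj 𝒜 j).rTensor R (D.braidedMul ((j v ⊗ₜ 1) ⊗ₜ t)) =
        (LinearMap.toSpanSingleton k V v).rTensor R
          ((Coalgebra.counit (R := k) (A := R)).rTensor R t) := by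
    induction t with
    | zero => simp only [TensorProduct.tmul_zero, map_zero]
    | add x y hx hy => simp only [map_add, TensorProduct.tmul_add, hx, hy]
    | tmul a b =>
      rw [YDData.braidedMul_tmul, hR.braiding_one_tmul]
      simp [hj.proj_mul hR zero_le_one]
  have proj_mul_right (v : V) (t : R ⊗[k] R) :
      (degreeOneProj 𝒜 j).rTensor R (D.braidedMul ((1 ⊗ₜ j v) ⊗ₜ t)) =
        (leftMul j).lTensor V (braidHead (DV.braiding DV) R
          (v ⊗ₜ (degreeOneProj 𝒜 j).rTensor R t)) := by
    induction t with
    | zero => simp only [TensorProduct.tmul_zero, map_zero]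
    | add x y hx hy => simp only [map_add, TensorProduct.tmul_add, hx, hy]
    | tmul a b =>
      rw [YDData.braidedMul_tmul, LinearMap.rTensor_tmul, braidHead_tmul, YDData.braiding_tmul,
        YDData.braiding_tmul, hj.isHom.map_coact]
      generalize DV.coact v = s
      induction s with
      | zero => simp only [map_zero, TensorProduct.zero_tmul]
      | add x y hx hy => simp only [map_add, TensorProduct.add_tmul, hx, hy]
      | tmul h u => simp [hj.proj_act hR, leftMul_tmul]
  induction x with
  | zero => simp only [map_zero, add_zero]
  | add x y hx hy => rw [map_add, map_add, hx, hy]; simp only [map_add]; abel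
  | tmul v x =>
    rw [leftMul_tmul, skewDer, LinearMap.comp_apply, hR.comul_mul,
      mem_primitives.1 (le_primitives hR.isGradedComul zero_le_one hR.counit_one (hj.mem v)),
      TensorProduct.add_tmul, map_add, map_add,
      proj_mul_left, proj_mul_right, Coalgebra.rTensor_counit_comul, add_comm,
      LinearMap.rTensor_tmul, LinearMap.toSpanSingleton_apply, one_smul, LinearMap.lTensor_tmul,
      LinearMap.comp_apply]

theorem skewDer_tensorPowerLift (hR : IsGradedBraidedHopfAlgebra D 𝒜) (zero_le_one : 𝒜 0 ≤ 1)
    (hj : IsDegreeOne D 𝒜 DV j) (n : ℕ) (t : ⨂[k]^(n + 1) V) :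
    skewDer 𝒜 j (tensorPowerLift j (n + 1) t) =
      (tensorPowerLift j n).lTensor V ((tensorCons k V n).symm (DV.cosetSum n t)) := by
  induction n with
  | zero =>
    have := hR.gradedMonoid
    obtain ⟨x, rfl⟩ := (tensorCons k V 0).surjective t
    have skewDer_comp_lift : skewDer 𝒜 j ∘ₗ tensorPowerLift j 0 = 0 :=
      LinearMap.ext fun t => by
        rw [LinearMap.comp_apply, tensorPowerLift_zero, map_smul, skewDer_one hR.comul_one,
          smul_zero, LinearMap.zero_apply]
    rw [tensorPowerLift_tensorCons, skewDer_leftMul hR zero_le_one hj,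
      ← LinearMap.lTensor_comp_apply, skewDer_comp_lift, YDData.cosetSum_zero,
      LinearMap.lTensor_zero, LinearMap.zero_apply, map_zero, map_zero, add_zero,
      Module.End.one_apply, LinearEquiv.symm_apply_apply]
  | succ n ih =>
    obtain ⟨x, rfl⟩ := (tensorCons k V (n + 1)).surjective t
    let f : ⨂[k]^(n + 1) V →ₗ[k] V ⊗[k] (⨂[k]^n V) :=
      (tensorCons k V n).symm.toLinearMap ∘ₗ DV.cosetSum n
    have skewDer_comp_lift : skewDer 𝒜 j ∘ₗ tensorPowerLift j (n + 1) =
        (tensorPowerLift j n).lTensor V ∘ₗ f := LinearMap.ext ih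
    have shiftEnd_cosetSum : shiftEnd (n + 1) (DV.cosetSum n) (tensorCons k V (n + 1) x) =
        tensorConsCons k V n (f.lTensor V x) := by
      rw [shiftEnd_tensorCons, tensorConsCons_apply, ← LinearMap.lTensor_comp_apply]
      congr 3
      exact LinearMap.ext fun t => ((tensorCons k V n).apply_symm_apply _).symm
    rw [tensorPowerLift_tensorCons, skewDer_leftMul hR zero_le_one hj,
      ← LinearMap.lTensor_comp_apply, skewDer_comp_lift, YDData.cosetSum_succ,
      LinearMap.add_apply, Module.End.one_apply, Module.End.mul_apply, shiftEnd_cosetSum,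
      YDData.sigma_zero, map_add, LinearEquiv.symm_apply_apply, map_add,
      tensorConsCons_apply, LinearEquiv.symm_apply_apply, ← LinearMap.lTensor_comp_apply V _
        (tensorCons k V n).toLinearMap, tensorPowerLift_comp_tensorCons,
      LinearMap.lTensor_comp_apply V (leftMul j), LinearMap.lTensor_comp_apply V _ f]
    exact congrArg (_ + (leftMul j).lTensor V ·)
      (LinearMap.congr_fun (braidHead_comp_lTensor_lTensor _ (tensorPowerLift j n)) _)

/-- By the Leibniz rule, both sides satisfy the recursion
`𝔖^{n+1} = (id ⊗ 𝔖ⁿ)(1 + σ₀ + σ₀σ₁ + ⋯)`. -/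
theorem iterSkewDer_tensorPowerLift (hR : IsGradedBraidedHopfAlgebra D 𝒜) (zero_le_one : 𝒜 0 ≤ 1)
    (hj : IsDegreeOne D 𝒜 DV j) (n : ℕ) (t : ⨂[k]^n V) :
    iterSkewDer 𝒜 j n (tensorPowerLift j n t) = DV.symmetrizer n t := by
  induction n with
  | zero =>
    rw [YDData.symmetrizer_zero, tensorPowerLift_zero, map_smul, iterSkewDer,
      LinearMap.comp_apply, hR.counit_one, Module.End.one_apply, ← map_smul, smul_eq_mul, mul_one]
    exact LinearEquiv.symm_apply_apply _ t
  | succ n ih =>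
    have iterSkewDer_comp_lift : iterSkewDer 𝒜 j n ∘ₗ tensorPowerLift j n = DV.symmetrizer n :=
      LinearMap.ext ih
    obtain ⟨x, hx⟩ := (tensorCons k V n).surjective (DV.cosetSum n t)
    rw [YDData.symmetrizer_succ (hj.isYangBaxter hR.yetterDrinfeld), Module.End.mul_apply,
      iterSkewDer, LinearMap.comp_apply, LinearMap.comp_apply,
      skewDer_tensorPowerLift hR zero_le_one hj, ← hx, LinearEquiv.symm_apply_apply,
      ← LinearMap.lTensor_comp_apply, iterSkewDer_comp_lift, shiftEnd_tensorCons,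
      LinearEquiv.coe_coe]

theorem tensorPowerLift_eq_zero_iff (hR : IsGradedBraidedHopfAlgebra D 𝒜) (zero_le_one : 𝒜 0 ≤ 1)
    (primitives_le : primitives k R ≤ 𝒜 1) (hj : IsDegreeOne D 𝒜 DV j) (n : ℕ)
    (t : ⨂[k]^n V) : tensorPowerLift j n t = 0 ↔ DV.symmetrizer n t = 0 := by
  have := hR.gradedMonoid
  rw [← iterSkewDer_tensorPowerLift hR zero_le_one hj]
  refine ⟨fun h => by rw [h, map_zero], fun h => ?_⟩
  exact iterSkewDer_injOn hR zero_le_one primitives_le hj n (tensorPowerLift_mem hj.mem n t)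
    (zero_mem _) (h.trans (map_zero _).symm)

theorem ker_lift_eq_ker_quantumSymmetrizer (hR : IsGradedBraidedHopfAlgebra D 𝒜)
    (zero_le_one : 𝒜 0 ≤ 1) (primitives_le : primitives k R ≤ 𝒜 1) (hj : IsDegreeOne D 𝒜 DV j) :
    LinearMap.ker (TensorAlgebra.lift k j).toLinearMap = LinearMap.ker DV.quantumSymmetrizer := by
  have := hR.gradedMonoid
  ext x
  have lift_eq_zero_iff : TensorAlgebra.lift k j x = 0 ↔
      ∀ n, tensorPowerLift j n (TensorAlgebra.equivDirectSum x n) = 0 := by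
    simp only [← gradedProj_lift hj.mem]
    exact ⟨fun h n => by rw [h, map_zero], eq_zero_of_gradedProj_eq_zero⟩
  have symmetrizer_eq_zero_iff : DV.quantumSymmetrizer x = 0 ↔
      ∀ n, DV.symmetrizer n (TensorAlgebra.equivDirectSum x n) = 0 :=
    DFinsupp.ext_iff
  rw [LinearMap.mem_ker, LinearMap.mem_ker, AlgHom.toLinearMap_apply, lift_eq_zero_iff,
    symmetrizer_eq_zero_iff]
  exact forall_congr' fun n => tensorPowerLift_eq_zero_iff hR zero_le_one primitives_le hj n _

end SkewDerivation

section Surjective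

variable {k R V : Type*} [CommRing k] [Ring R] [Algebra k R] [AddCommGroup V] [Module k V]

theorem map_lift_range_ι_pow (j : V →ₗ[k] R) (n : ℕ) :
    (LinearMap.range (TensorAlgebra.ι k : V →ₗ[k] TensorAlgebra k V) ^ n).map
      (TensorAlgebra.lift k j).toLinearMap = LinearMap.range j ^ n := by
  rw [Submodule.map_pow, ← LinearMap.range_comp, TensorAlgebra.ι_comp_lift]

theorem surjective_lift_of_iSup_range_pow {j : V →ₗ[k] R}
    (hj : ⨆ n, LinearMap.range j ^ n = ⊤) : Function.Surjective (TensorAlgebra.lift k j) := by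
  refine LinearMap.range_eq_top.1 (top_le_iff.1 ?_ :
    LinearMap.range (TensorAlgebra.lift k j).toLinearMap = ⊤)
  exact hj ▸ iSup_le fun n => map_lift_range_ι_pow j n ▸ LinearMap.map_le_range

end Surjective

/-! ### Compatibility of `A(V) → R` with the structure maps -/

section Morphisms

variable {k H : Type*} [Field k] [Ring H] [HopfAlgebra k H]

namespace YDData

theorem isHom_subtype {M : Type*} [AddCommGroup M] [Module k M] (D : YDData k H M)
    (W : Submodule k M) (hW : D.IsSub W) : (D.restrict W hW).IsHom D W.subtype where
  map_act _ _ := rfl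
  map_coact w := (congrArg Subtype.val <|
    LinearEquiv.apply_symm_apply (LinearEquiv.ofInjective (W.subtype.lTensor H)
      (Module.Flat.lTensor_preserves_injective_linearMap _ W.injective_subtype))
      (LinearMap.codRestrict _ (D.coact ∘ₗ W.subtype) (fun w => hW.coact_mem w w.2) w)).symm

theorem IsHom.comp {M N P : Type*} [AddCommGroup M] [Module k M] [AddCommGroup N]
    [Module k N] [AddCommGroup P] [Module k P] {DM : YDData k H M} {DN : YDData k H N}
    {DP : YDData k H P} {g : N →ₗ[k] P} {f : M →ₗ[k] N} (hg : DN.IsHom DP g)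
    (hf : DM.IsHom DN f) : DM.IsHom DP (g ∘ₗ f) where
  map_act h m := by rw [LinearMap.comp_apply, hf.map_act, hg.map_act, LinearMap.comp_apply]
  map_coact m := by
    rw [LinearMap.comp_apply, hg.map_coact, hf.map_coact, LinearMap.lTensor_comp_apply]

theorem IsHom.map_braidedMul {R T : Type*} [Ring R] [Algebra k R] [Ring T] [Algebra k T]
    {D : YDData k H R} {DT : YDData k H T} {p : T →ₐ[k] R} (hp : DT.IsHom D p.toLinearMap)
    (s t : T ⊗[k] T) :
    TensorProduct.map p.toLinearMap p.toLinearMap (DT.braidedMul (s ⊗ₜ t)) =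
      D.braidedMul (TensorProduct.map p.toLinearMap p.toLinearMap s ⊗ₜ
        TensorProduct.map p.toLinearMap p.toLinearMap t) := by
  induction s with
  | zero => simp only [TensorProduct.zero_tmul, map_zero]
  | add x y hx hy => simp only [TensorProduct.add_tmul, map_add, hx, hy]
  | tmul a b =>
    induction t with
    | zero => simp only [TensorProduct.tmul_zero, map_zero]
    | add x y hx hy => simp only [TensorProduct.tmul_add, map_add, hx, hy]
    | tmul a' b' =>
      rw [TensorProduct.map_tmul, TensorProduct.map_tmul, braidedMul_tmul, braidedMul_tmul,
        ← TensorProduct.map_tmul p.toLinearMap p.toLinearMap b a',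
        ← LinearMap.comp_apply (D.braiding D), ← hp.map_comp_braiding, LinearMap.comp_apply]
      generalize DT.braiding DT (b ⊗ₜ a') = z
      induction z with
      | zero => simp only [map_zero]
      | add x y hx hy => simp only [map_add, hx, hy]
      | tmul x y => simp

end YDData

theorem IsDegreeOne.comp_linearEquiv {R V W : Type*} [Ring R] [Algebra k R] [AddCommGroup V]
    [Module k V] [AddCommGroup W] [Module k W] {D : YDData k H R} {𝒜 : ℕ → Submodule k R}
    {DV : YDData k H V} {DW : YDData k H W} {j : V →ₗ[k] R} (hj : IsDegreeOne D 𝒜 DV j)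
    {f : W ≃ₗ[k] V} (hf : DW.IsHom DV f.toLinearMap) :
    IsDegreeOne D 𝒜 DW (j ∘ₗ f.toLinearMap) where
  injective := hj.injective.comp f.injective
  range_eq := by rw [LinearMap.range_comp, LinearEquiv.range, Submodule.map_top, hj.range_eq]
  isHom := hj.isHom.comp hf

end Morphisms

section Lift

variable {k H R V : Type*} [Field k] [Ring H] [HopfAlgebra k H] [Ring R] [Algebra k R]
  [Coalgebra k R] [AddCommGroup V] [Module k V] {D : YDData k H R} {DV : YDData k H V}
  {j : V →ₗ[k] R}

namespace IsBraidedHopfAlgebra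

theorem act_mul (hR : IsBraidedHopfAlgebra D) (h : H) (x y : R) :
    D.act h (x * y) = LinearMap.mul' k R
      (TensorProduct.map (D.act.flip x) (D.act.flip y) (Coalgebra.comul (R := k) h)) := by
  rw [← YDData.tensor_act_tmul, hR.mul_hom.map_act, LinearMap.mul'_apply]

theorem act_algebraMap (hR : IsBraidedHopfAlgebra D) (h : H) (r : k) :
    D.act h (algebraMap k R r) = algebraMap k R (Coalgebra.counit (R := k) h * r) :=
  (hR.unit_hom.map_act h r).symm

theorem coact_mul (hR : IsBraidedHopfAlgebra D) (x y : R) :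
    D.coact (x * y) = D.coact x * D.coact y := by
  have h := hR.mul_hom.map_coact (x ⊗ₜ y)
  rw [LinearMap.mul'_apply, YDData.tensor_coact_tmul] at h
  rw [h]
  generalize D.coact x = s
  generalize D.coact y = t
  induction s with
  | zero => simp only [TensorProduct.zero_tmul, map_zero, zero_mul]
  | add x y hx hy => simp only [TensorProduct.add_tmul, map_add, hx, hy, add_mul]
  | tmul a b =>
    induction t with
    | zero => simp only [TensorProduct.tmul_zero, map_zero, mul_zero]
    | add x y hx hy => simp only [TensorProduct.tmul_add, map_add, hx, hy, mul_add]
    | tmul a' b' => simp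

theorem coact_algebraMap (hR : IsBraidedHopfAlgebra D) (r : k) :
    D.coact (algebraMap k R r) = algebraMap k (H ⊗[k] R) r := by
  rw [Algebra.TensorProduct.algebraMap_apply', ← Algebra.linearMap_apply, hR.unit_hom.map_coact]
  rfl

theorem act_lift (hR : IsBraidedHopfAlgebra D) (hj : ∀ h v, j (DV.act h v) = D.act h (j v)) (h : H)
    (x : TensorAlgebra k V) :
    TensorAlgebra.lift k j (DV.tensorAlgebra.act h x) = D.act h (TensorAlgebra.lift k j x) := by
  change TensorAlgebra.lift k j ((DV.tensorAlgebraOrbit x).ofConv h) = _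
  induction x using TensorAlgebra.induction generalizing h with
  | algebraMap r =>
    rw [AlgHom.commutes, AlgHom.commutes, hR.act_algebraMap,
      Algebra.algebraMap_eq_smul_one r, WithConv.ofConv_smul, LinearMap.smul_apply, map_smul,
      LinearMap.convOne_apply, AlgHom.commutes, mul_comm, map_mul, Algebra.smul_def]
  | ι v =>
    rw [YDData.tensorAlgebraOrbit, TensorAlgebra.lift_ι_apply, TensorAlgebra.lift_ι_apply, ← hj]
    exact TensorAlgebra.lift_ι_apply _ _
  | mul x y hx hy =>
    rw [map_mul, map_mul, hR.act_mul, LinearMap.convMul_apply]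
    generalize Coalgebra.comul (R := k) h = s
    induction s with
    | zero => simp only [map_zero]
    | add x y hx hy => simp only [map_add, hx, hy]
    | tmul a b => simp [hx, hy]
  | add x y hx hy =>
    rw [map_add, map_add, map_add, WithConv.ofConv_add, LinearMap.add_apply, map_add, hx, hy]

theorem coact_lift (hR : IsBraidedHopfAlgebra D)
    (hj : ∀ v, D.coact (j v) = j.lTensor H (DV.coact v)) (x : TensorAlgebra k V) :
    D.coact (TensorAlgebra.lift k j x) =
      (TensorAlgebra.lift k j).toLinearMap.lTensor H (DV.tensorAlgebra.coact x) := by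
  change _ = Algebra.TensorProduct.map (AlgHom.id k H) (TensorAlgebra.lift k j)
    (TensorAlgebra.lift k ((TensorAlgebra.ι k).lTensor H ∘ₗ DV.coact) x)
  induction x using TensorAlgebra.induction with
  | algebraMap r => rw [AlgHom.commutes, AlgHom.commutes, AlgHom.commutes, hR.coact_algebraMap]
  | ι v =>
    rw [TensorAlgebra.lift_ι_apply, TensorAlgebra.lift_ι_apply, hj, LinearMap.comp_apply]
    conv_lhs => rw [← TensorAlgebra.ι_comp_lift j]
    exact LinearMap.lTensor_comp_apply _ _ _ _
  | mul x y hx hy => rw [map_mul (TensorAlgebra.lift k j), hR.coact_mul, hx, hy, map_mul, map_mul]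
  | add x y hx hy => rw [map_add, map_add, map_add, map_add, hx, hy]

theorem isHom_lift (hR : IsBraidedHopfAlgebra D) (hj : DV.IsHom D j) :
    DV.tensorAlgebra.IsHom D (TensorAlgebra.lift k j).toLinearMap where
  map_act := hR.act_lift hj.map_act
  map_coact := hR.coact_lift hj.map_coact

theorem counit_lift (hR : IsBraidedHopfAlgebra D) (hj : ∀ v, j v ∈ primitives k R)
    (x : TensorAlgebra k V) :
    Coalgebra.counit (R := k) (TensorAlgebra.lift k j x) = TensorAlgebra.algebraMapInv x := by
  induction x using TensorAlgebra.induction with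
  | algebraMap r =>
    rw [AlgHom.commutes, AlgHom.commutes, Algebra.algebraMap_eq_smul_one, map_smul, hR.counit_one,
      Algebra.algebraMap_eq_smul_one]
  | ι v =>
    rw [TensorAlgebra.lift_ι_apply, counit_of_mem_primitives hR.counit_one (hj v),
      TensorAlgebra.algebraMapInv, TensorAlgebra.lift_ι_apply, LinearMap.zero_apply]
  | mul x y hx hy => rw [map_mul (TensorAlgebra.lift k j), hR.counit_mul, hx, hy, map_mul]
  | add x y hx hy => rw [map_add, map_add, map_add, hx, hy]

end IsBraidedHopfAlgebra

theorem YDData.tensorAlgebraComul_ι_mul (DV : YDData k H V) (v : V) (y : TensorAlgebra k V) :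
    DV.tensorAlgebraComul (TensorAlgebra.ι k v * y) = DV.tensorAlgebra.braidedMul
      ((1 ⊗ₜ TensorAlgebra.ι k v + TensorAlgebra.ι k v ⊗ₜ 1) ⊗ₜ DV.tensorAlgebraComul y) := by
  simp [tensorAlgebraComul, tensorAlgebraComulAux, TensorProduct.add_tmul, add_comm]

/-- Since the multiplicativity of the comultiplication of `A(V)` is only known for the left
multiplication by elements of `V`, the induction is on the left factor `x` of a product `x y`. -/
theorem IsBraidedHopfAlgebra.comul_lift (hR : IsBraidedHopfAlgebra D) (hj : DV.IsHom D j)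
    (hj_mem : ∀ v, j v ∈ primitives k R) (x : TensorAlgebra k V) :
    Coalgebra.comul (R := k) (TensorAlgebra.lift k j x) =
      TensorProduct.map (TensorAlgebra.lift k j).toLinearMap (TensorAlgebra.lift k j).toLinearMap
        (DV.tensorAlgebraComul x) := by
  let E : Submodule k (TensorAlgebra k V) :=
    LinearMap.eqLocus (Coalgebra.comul ∘ₗ (TensorAlgebra.lift k j).toLinearMap)
      (TensorProduct.map (TensorAlgebra.lift k j).toLinearMap (TensorAlgebra.lift k j).toLinearMap
        ∘ₗ DV.tensorAlgebraComul)
  have one_mem : 1 ∈ E := by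
    simp [E, LinearMap.mem_eqLocus, YDData.tensorAlgebraComul, hR.comul_one]
  suffices mul_mem : ∀ y ∈ E, x * y ∈ E from mul_one x ▸ mul_mem 1 one_mem
  induction x using TensorAlgebra.induction with
  | algebraMap r => exact fun y hy => Algebra.smul_def r y ▸ E.smul_mem r hy
  | ι v =>
    intro y hy
    simp only [E, LinearMap.mem_eqLocus, LinearMap.comp_apply, AlgHom.toLinearMap_apply] at hy ⊢
    rw [YDData.tensorAlgebraComul_ι_mul, (hR.isHom_lift hj).map_braidedMul, ← hy, map_mul,
      hR.comul_mul, TensorAlgebra.lift_ι_apply, mem_primitives.1 (hj_mem v), map_add,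
      TensorProduct.map_tmul, TensorProduct.map_tmul, AlgHom.toLinearMap_apply,
      AlgHom.toLinearMap_apply, map_one, TensorAlgebra.lift_ι_apply]
  | mul x y hx hy => exact fun z hz => (mul_assoc x y z).symm ▸ hx _ (hy z hz)
  | add x y hx hy => exact fun z hz => (add_mul x y z).symm ▸ add_mem (hx z hz) (hy z hz)

end Lift

section Nichols

variable {k H R V : Type*} [Field k] [Ring H] [HopfAlgebra k H] [Ring R] [Algebra k R]
  [Coalgebra k R] [AddCommGroup V] [Module k V] {D : YDData k H R} {𝒜 : ℕ → Submodule k R}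
  {DV : YDData k H V} {j : V →ₗ[k] R}

namespace YDData.IsNicholsIso

variable {R' : Type*} [Ring R'] [Algebra k R'] [Coalgebra k R'] {D' : YDData k H R'}
  {𝒜' : ℕ → Submodule k R'} {φ : DV.NicholsAlgebra ≃ₗ[k] R} {φ' : DV.NicholsAlgebra ≃ₗ[k] R'}

/-- The isomorphism `R ≃ 𝔅(V) ≃ R'` between two models of `𝔅(V)`. -/
noncomputable def algEquiv (hφ : DV.IsNicholsIso D 𝒜 φ) (hφ' : DV.IsNicholsIso D' 𝒜' φ') :
    R ≃ₐ[k] R' :=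
  AlgEquiv.ofLinearEquiv (φ.symm.trans φ')
    (by rw [← hφ.map_one, LinearEquiv.trans_apply, φ.symm_apply_apply, hφ'.map_one])
    (fun x y => by
      obtain ⟨x, rfl⟩ := (φ.surjective.comp (Submodule.mkQ_surjective _)) x
      obtain ⟨y, rfl⟩ := (φ.surjective.comp (Submodule.mkQ_surjective _)) y
      simp only [Function.comp_apply, ← hφ.map_mul, LinearEquiv.trans_apply,
        φ.symm_apply_apply, hφ'.map_mul])

theorem algEquiv_apply (hφ : DV.IsNicholsIso D 𝒜 φ) (hφ' : DV.IsNicholsIso D' 𝒜' φ')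
    (x : DV.NicholsAlgebra) : hφ.algEquiv hφ' (φ x) = φ' x :=
  congrArg φ' (φ.symm_apply_apply x)

theorem isGradedBraidedHopfIso_algEquiv (hφ : DV.IsNicholsIso D 𝒜 φ)
    (hφ' : DV.IsNicholsIso D' 𝒜' φ') :
    IsGradedBraidedHopfIso D 𝒜 D' 𝒜' (hφ.algEquiv hφ') := by
  have surjective : Function.Surjective (φ.toLinearMap ∘ₗ DV.toNichols) :=
    φ.surjective.comp (Submodule.mkQ_surjective _)
  have comp_eq : (hφ.algEquiv hφ').toLinearMap ∘ₗ φ.toLinearMap ∘ₗ DV.toNichols =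
      φ'.toLinearMap ∘ₗ DV.toNichols :=
    LinearMap.ext fun x => hφ.algEquiv_apply hφ' (DV.toNichols x)
  refine ⟨fun x => ?_, fun x => ?_, ⟨fun h x => ?_, fun x => ?_⟩, fun n => ?_⟩
  · obtain ⟨x, rfl⟩ := surjective x
    simp only [LinearMap.comp_apply, LinearEquiv.coe_coe]
    rw [algEquiv_apply, hφ.map_counit, hφ'.map_counit]
  · obtain ⟨x, rfl⟩ := surjective x
    simp only [LinearMap.comp_apply, LinearEquiv.coe_coe]
    rw [algEquiv_apply, hφ.map_comul, hφ'.map_comul, TensorProduct.map_map, comp_eq]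
  · obtain ⟨x, rfl⟩ := surjective x
    rw [← hφ.map_yetterDrinfeld.map_act, ← LinearMap.comp_apply, comp_eq,
      hφ'.map_yetterDrinfeld.map_act, ← comp_eq, LinearMap.comp_apply]
  · obtain ⟨x, rfl⟩ := surjective x
    rw [← LinearMap.comp_apply (hφ.algEquiv hφ').toLinearMap, comp_eq,
      hφ.map_yetterDrinfeld.map_coact,
      hφ'.map_yetterDrinfeld.map_coact, ← LinearMap.lTensor_comp_apply, comp_eq]
  · rw [← hφ.map_grading n, ← hφ'.map_grading n, ← comp_eq,
      Submodule.map_comp _ (hφ.algEquiv hφ').toLinearMap]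

end YDData.IsNicholsIso

namespace IsTOBA

theorem isDegreeOne (hR : IsTOBA D 𝒜) : IsDegreeOne D 𝒜 hR.degreeOne (𝒜 1).subtype where
  injective := Submodule.injective_subtype _
  range_eq := Submodule.range_subtype _
  isHom := D.isHom_subtype _ (hR.isSub 1)

theorem eq_pow (hR : IsTOBA D 𝒜) (n : ℕ) : 𝒜 n = 𝒜 1 ^ n := by
  let := hR.isInternal.chooseDecomposition
  have := hR.gradedMonoid
  exact eq_pow_of_iSup_le_mul hR.zero_le_one hR.sq_augmentation.ge n

theorem surjective_lift (hR : IsTOBA D 𝒜) (hj : IsDegreeOne D 𝒜 DV j) :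
    Function.Surjective (TensorAlgebra.lift k j) :=
  surjective_lift_of_iSup_range_pow <| by
    simp only [hj.range_eq, ← hR.eq_pow, hR.isInternal.submodule_iSup_eq_top]

theorem ker_lift (hR : IsTOBA D 𝒜) (hj : IsDegreeOne D 𝒜 DV j) :
    LinearMap.ker (TensorAlgebra.lift k j).toLinearMap = LinearMap.ker DV.quantumSymmetrizer := by
  let := hR.isInternal.chooseDecomposition
  exact ker_lift_eq_ker_quantumSymmetrizer hR.toIsGradedBraidedHopfAlgebra hR.zero_le_one
    hR.primitives_eq.le hj

/-- The isomorphism `𝔅(V) ≃ R` induced by `A(V) → R`. -/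
noncomputable def nicholsEquiv (hR : IsTOBA D 𝒜) (hj : IsDegreeOne D 𝒜 DV j) :
    DV.NicholsAlgebra ≃ₗ[k] R :=
  (Submodule.quotEquivOfEq _ _ (hR.ker_lift hj).symm).trans
    ((TensorAlgebra.lift k j).toLinearMap.quotKerEquivOfSurjective (hR.surjective_lift hj))

theorem nicholsEquiv_toNichols (hR : IsTOBA D 𝒜) (hj : IsDegreeOne D 𝒜 DV j)
    (x : TensorAlgebra k V) :
    hR.nicholsEquiv hj (DV.toNichols x) = TensorAlgebra.lift k j x :=
  rfl

theorem isNicholsIso (hR : IsTOBA D 𝒜) (hj : IsDegreeOne D 𝒜 DV j) :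
    DV.IsNicholsIso D 𝒜 (hR.nicholsEquiv hj) where
  map_one := map_one (TensorAlgebra.lift k j)
  map_mul := map_mul (TensorAlgebra.lift k j)
  map_counit := hR.counit_lift fun v => hR.primitives_eq.ge (hj.mem v)
  map_comul := hR.comul_lift hj.isHom fun v => hR.primitives_eq.ge (hj.mem v)
  map_yetterDrinfeld := hR.isHom_lift hj.isHom
  map_grading n := by
    rw [hR.eq_pow n, ← hj.range_eq]
    exact map_lift_range_ι_pow j n

theorem exists_isGradedBraidedHopfIso {R' : Type*} [Ring R'] [Algebra k R'] [Coalgebra k R']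
    {D' : YDData k H R'} {𝒜' : ℕ → Submodule k R'} {j' : V →ₗ[k] R'} (hR : IsTOBA D 𝒜)
    (hj : IsDegreeOne D 𝒜 DV j) (hR' : IsTOBA D' 𝒜') (hj' : IsDegreeOne D' 𝒜' DV j') :
    ∃ F : R ≃ₐ[k] R', IsGradedBraidedHopfIso D 𝒜 D' 𝒜' F ∧ ∀ v, F (j v) = j' v := by
  have hφ := hR.isNicholsIso hj
  have hφ' := hR'.isNicholsIso hj'
  refine ⟨hφ.algEquiv hφ', hφ.isGradedBraidedHopfIso_algEquiv hφ', fun v => ?_⟩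
  have h := hφ.algEquiv_apply hφ' (DV.toNichols (TensorAlgebra.ι k v))
  rwa [nicholsEquiv_toNichols, nicholsEquiv_toNichols, TensorAlgebra.lift_ι_apply,
    TensorAlgebra.lift_ι_apply] at h

end IsTOBA

end Nichols

theorem mainTheorem1_general {k H R : Type*}
    [Field k] [Ring H] [HopfAlgebra k H]
    [Ring R] [Algebra k R] [Coalgebra k R]
    (D : YDData k H R) (𝒜 : ℕ → Submodule k R) (hR : IsTOBA D 𝒜) :
    Function.Surjective (TensorAlgebra.lift k (𝒜 1).subtype) ∧
    LinearMap.ker (TensorAlgebra.lift k (𝒜 1).subtype).toLinearMap =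
      LinearMap.ker hR.degreeOne.quantumSymmetrizer ∧
    (∃ φ : hR.degreeOne.NicholsAlgebra ≃ₗ[k] R,
      (∀ x, φ (hR.degreeOne.toNichols x) = TensorAlgebra.lift k (𝒜 1).subtype x) ∧
      hR.degreeOne.IsNicholsIso D 𝒜 φ) ∧
    (∀ {R' : Type*} [Ring R'] [Algebra k R'] [Coalgebra k R']
      (D' : YDData k H R') (𝒜' : ℕ → Submodule k R') (hR' : IsTOBA D' 𝒜')
      (f : 𝒜 1 ≃ₗ[k] 𝒜' 1), hR.degreeOne.IsHom hR'.degreeOne f.toLinearMap →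
      ∃ F : R ≃ₐ[k] R', IsGradedBraidedHopfIso D 𝒜 D' 𝒜' F ∧ ∀ v : 𝒜 1, F v = f v) :=
  ⟨hR.surjective_lift hR.isDegreeOne, hR.ker_lift hR.isDegreeOne,
    ⟨hR.nicholsEquiv hR.isDegreeOne, hR.nicholsEquiv_toNichols hR.isDegreeOne,
      hR.isNicholsIso hR.isDegreeOne⟩,
    fun _ _ hR' _ hf => hR.exists_isGradedBraidedHopfIso hR.isDegreeOne hR'
      (hR'.isDegreeOne.comp_linearEquiv hf)⟩

theorem mainTheorem1 {k H R : Type*}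
    [Field k] [Ring H] [HopfAlgebra k H]
    (hS : Function.Bijective (HopfAlgebra.antipode k : H → H))
    [Ring R] [Algebra k R] [Coalgebra k R]
    (D : YDData k H R) (𝒜 : ℕ → Submodule k R) (hR : IsTOBA D 𝒜) :
    -- the canonical algebra map `A(V) → R`, `V = R(1)`, is onto, with kernel `ker 𝔖`
    Function.Surjective (TensorAlgebra.lift k (𝒜 1).subtype) ∧
    LinearMap.ker (TensorAlgebra.lift k (𝒜 1).subtype).toLinearMap =
      LinearMap.ker hR.degreeOne.quantumSymmetrizer ∧
    -- it induces an isomorphism `𝔅(V) ≃ R` of graded braided Hopf algebras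
    (∃ φ : hR.degreeOne.NicholsAlgebra ≃ₗ[k] R,
      (∀ x, φ (hR.degreeOne.toNichols x) = TensorAlgebra.lift k (𝒜 1).subtype x) ∧
      hR.degreeOne.IsNicholsIso D 𝒜 φ) ∧
    -- TOBAs with isomorphic spaces of primitive elements are isomorphic
    (∀ {R' : Type*} [Ring R'] [Algebra k R'] [Coalgebra k R']
      (D' : YDData k H R') (𝒜' : ℕ → Submodule k R') (hR' : IsTOBA D' 𝒜')
      (f : 𝒜 1 ≃ₗ[k] 𝒜' 1), hR.degreeOne.IsHom hR'.degreeOne f.toLinearMap →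
      ∃ F : R ≃ₐ[k] R', IsGradedBraidedHopfIso D 𝒜 D' 𝒜' F ∧ ∀ v : 𝒜 1, F v = f v) :=
  mainTheorem1_general D 𝒜 hR
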